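/- Let $\Bbbk$ be a field of characteristic zero, $Q$ a finite quiver (paths are written from left to right, $E=\Bbbk Q_0$ is spanned by the trivial paths), $I$ an admissible ideal of $\Bbbk Q$, and $A=\Bbbk Q/I$. Assume that $A$ is gentle: for each arrow $\alpha$ there is at most one arrow $\beta$ with $t(\alpha)=s(\beta)$ and $\alpha\beta\in I$, at most one with $t(\alpha)=s(\beta)$ and $\alpha\beta\notin I$, at most one arrow $\gamma$ with $t(\gamma)=s(\alpha)$ and $\gamma\alpha\in I$, at most one with $t(\gamma)=s(\alpha)$ and $\gamma\alpha\notin I$; and $I$ is generated by the paths of length two that it contains. Let $AP_2$ (resp. $AP_3$) be the set of paths $(\alpha_1,\alpha_2)$ with $\alpha_1\alpha_2\in I$ (resp. $(\alpha_1,\alpha_2,\alpha_3)$ with $\alpha_1\alpha_2,\alpha_2\alpha_3\in I$), and $B^1(A)[1]=\operatorname{Hom}_{E-E}(\Bbbk AP_2,A)$, the degree one part of the shifted Bardzell complex. For $f\in B^1(A)[1]$ put $\delta^2(f)(\alpha_1,\alpha_2,\alpha_3)=\alpha_1f(\alpha_2,\alpha_3)-f(\alpha_1,\alpha_2)\alpha_3$;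 $f$ is a $2$-cocycle if $\delta^2(f)=0$. On $B^1(A)[1]$ the brackets $l_n$ of the $L_\infty$-structure are as follows. For a bilinear map $g:A\otimes_\Bbbk A\to A$ and a second one $h$, let $[g,h]=g(h\otimes\mathrm{Id}-\mathrm{Id}\otimes h)+h(g\otimes\mathrm{Id}-\mathrm{Id}\otimes g)$. For paths $u=\beta_1\cdots\beta_m$, $v=\gamma_1\cdots\gamma_r$ of positive length, nonzero in $A$, let $\Theta=1$ if $(\beta_m,\gamma_1)\in AP_2$ and $\Theta=0$ otherwise; for $f\in B^1(A)[1]$ and a trilinear map $w:A^{\otimes 3}\to A$ let $$(G^*f)(u\otimes v)=\Theta\,\beta_1\cdots\beta_{m-1}f(\beta_m,\gamma_1)\gamma_2\cdots\gamma_r,$$ $$(H^*w)(u\otimes v)=\Theta\, w(\beta_1\cdots\beta_{m-1}\otimes\beta_m\otimes\gamma_1)\gamma_2\cdots\gamma_r-\sum_{i=2}^r w(u\otimes\gamma_1\cdots\gamma_{i-1}\otimes\gamma_i)\gamma_{i+1}\cdots\gamma_r$$ (where an empty product is the trivial path), and let $G^*f$ and $H^*w$ vanish if $u$ or $v$ is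 a trivial path. Put $\phi_1=G^*$ and, for $n\ge 2$, $\phi_n=H^*v_n$ and $$v_n(f_1,\dots,f_n)=\sum_{t=1}^{n-1}\sum_{\tau}(-1)^{(t-1)+(n-t-1)t}\,[\phi_t(f_{\tau(1)},\dots,f_{\tau(t)}),\phi_{n-t}(f_{\tau(t+1)},\dots,f_{\tau(n)})],$$ where $\tau$ runs over the $(t,n-t)$-shuffles with $\tau(1)<\tau(t+1)$. Then $l_1=-\delta^2$ and $l_n(f_1,\dots,f_n)(\alpha_1,\alpha_2,\alpha_3)=v_n(f_1,\dots,f_n)(\alpha_1\otimes\alpha_2\otimes\alpha_3)$ for $n\ge 2$ and $(\alpha_1,\alpha_2,\alpha_3)\in AP_3$. Assume that $Q$ has no oriented cycles and no parallel arrows, and that it contains no subquiver of the form $(\star)$, that is: there are no vertices $1,\dots,6$, arrows $\alpha_1:1\to2$, $\alpha_2:2\to3$, $\alpha_3:3\to4$, $\gamma_1:2\to5$, $\gamma_2:5\to3$, $\rho:5\to6$, $\delta_1:3\to6$, a path $v'\neq\alpha_1$ of positive length from $1$ to $2$, and a path $\delta_2\cdots\delta_s$ of positive length from $6$ to $4$,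 such that $\alpha_1\alpha_2=0=\alpha_2\alpha_3$ in $A$ and $v'$, $\gamma_1\gamma_2$ and $\delta_1\delta_2\cdots\delta_s$ are nonzero in $A$. Let $f=\sum_{i\ge1}f_it^i$ be a formal power series with $f_i\in B^1(A)[1]$ (for instance a polynomial $\sum_{i=1}^m f_it^i$). Then $f$ satisfies the generalized Maurer–Cartan equation $$l_1(f)-\sum_{n\ge2}(-1)^{\frac{(n+1)n}{2}}\frac1{n!}\,l_n(f,\dots,f)=0$$ (with the $l_n$ extended $t$-multilinearly, i.e. for every $i\ge 1$: $l_1(f_i)-\sum_{n\ge2}\sum_{j_1+\cdots+j_n=i,\ j_a\ge1}(-1)^{\frac{(n+1)n}{2}}\frac1{n!}l_n(f_{j_1},\dots,f_{j_n})=0$) if and only if $f_i$ is a $2$-cocycle for every $i\ge1$. -/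

import Mathlib

noncomputable section

namespace GentleMC

open Quiver TensorProduct
open scoped Classical

/-! ### Quivers and paths -/

section Paths

/-- The arrows of the quiver `V`, with their source and target recorded. -/
abbrev Arrow (V : Type*) [Quiver V] : Type _ := Σ a : V, Σ b : V, (a ⟶ b)

/-- The (oriented) paths of the quiver `V`, including the trivial path at each vertex.
Paths are written from left to right. -/
abbrev QPath (V : Type*) [Quiver V] : Type _ := Σ a : V, Σ b : V, Path a b

variable {V : Type*} [Quiver V]

/-- Source of an arrow. -/
abbrev Arrow.src (α : Arrow V) : V := α.1

/-- Target of an arrow. -/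
abbrev Arrow.tgt (α : Arrow V) : V := α.2.1

/-- An arrow as a path of length one. -/
def Arrow.toQPath (α : Arrow V) : QPath V := ⟨α.1, α.2.1, α.2.2.toPath⟩

/-- The trivial path at a vertex. -/
def trivialPath (v : V) : QPath V := ⟨v, v, Path.nil⟩

/-- The length of a path. -/
def QPath.len (p : QPath V) : ℕ := p.2.2.length

/-- All the factorizations `p = x · e · y` of a path `p` from `a` to `b` with `e` an arrow. They
are listed from left to right: for `p = β₁ ⋯ βₘ` the `i`-th entry consists of
`x = β₁ ⋯ βᵢ₋₁`, `e = βᵢ`, `y = βᵢ₊₁ ⋯ βₘ`. -/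
def splitsAux {a : V} : ∀ {b : V}, Path a b → List (Σ c : V, Σ d : V, Path a c × (c ⟶ d) × Path d b)
  | _, Path.nil => []
  | _, Path.cons p e =>
      (splitsAux p).map (fun x => ⟨x.1, x.2.1, x.2.2.1, x.2.2.2.1, x.2.2.2.2.cons e⟩) ++
        [⟨_, _, p, e, Path.nil⟩]

/-- The factorizations of a path around each of its arrows, from left to right, as triples
`(β₁ ⋯ βᵢ₋₁, βᵢ, βᵢ₊₁ ⋯ βₘ)`. -/
def QPath.splits (p : QPath V) : List (QPath V × Arrow V × QPath V) :=
  (splitsAux p.2.2).map (fun x =>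
    (⟨p.1, x.1, x.2.2.1⟩, ⟨x.1, x.2.1, x.2.2.2.1⟩, ⟨x.2.1, p.2.1, x.2.2.2.2⟩))

end Paths

/-! ### The path algebra -/

section PathAlgebra

/-- The path algebra `k Q`: finite linear combinations of paths, with multiplication extending
concatenation of paths (the product of non-composable paths is zero). -/
def PathAlgebra (k V : Type*) [Field k] [Quiver V] : Type _ := QPath V →₀ k

variable {k V : Type*} [Field k] [Quiver V]

instance : AddCommGroup (PathAlgebra k V) := inferInstanceAs (AddCommGroup (QPath V →₀ k))

instance : Module k (PathAlgebra k V) := inferInstanceAs (Module k (QPath V →₀ k))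

/-- The paths form a basis of the path algebra. -/
def PathAlgebra.basis (k V : Type*) [Field k] [Quiver V] :
    Module.Basis (QPath V) k (PathAlgebra k V) := Finsupp.basisSingleOne

/-- A path as an element of the path algebra. -/
def PathAlgebra.ofPath (k : Type*) {V : Type*} [Field k] [Quiver V] (p : QPath V) :
    PathAlgebra k V := PathAlgebra.basis k V p

/-- The product of two paths in the path algebra. -/
def pathMul (k : Type*) {V : Type*} [Field k] [Quiver V] (p q : QPath V) : PathAlgebra k V :=
  if h : p.2.1 = q.1 then PathAlgebra.ofPath k ⟨p.1, q.2.1, p.2.2.comp (q.2.2.cast h.symm rfl)⟩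
  else 0

/-- Multiplication of the path algebra as a bilinear map. -/
def mulLin (k V : Type*) [Field k] [Quiver V] :
    PathAlgebra k V →ₗ[k] PathAlgebra k V →ₗ[k] PathAlgebra k V :=
  (PathAlgebra.basis k V).constr k fun p => (PathAlgebra.basis k V).constr k fun q => pathMul k p q

instance : Mul (PathAlgebra k V) := ⟨fun x y => mulLin k V x y⟩

theorem mul_eq_mulLin (x y : PathAlgebra k V) : x * y = mulLin k V x y := rfl

theorem ofPath_mul_ofPath (p q : QPath V) :
    PathAlgebra.ofPath k p * PathAlgebra.ofPath k q = pathMul k p q := by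
  simp [mul_eq_mulLin, mulLin, PathAlgebra.ofPath, Module.Basis.constr_basis]

theorem ofPath_mul_comp {a b c : V} (p : Path a b) (q : Path b c) :
    PathAlgebra.ofPath k (⟨a, b, p⟩ : QPath V) * PathAlgebra.ofPath k ⟨b, c, q⟩ =
      PathAlgebra.ofPath k ⟨a, c, p.comp q⟩ := by
  rw [ofPath_mul_ofPath]; simp [pathMul]

theorem ofPath_mul_ne (p q : QPath V) (h : p.2.1 ≠ q.1) :
    PathAlgebra.ofPath k p * PathAlgebra.ofPath k q = 0 := by
  rw [ofPath_mul_ofPath]; simp [pathMul, h]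

theorem pathAlgebra_induction {P : PathAlgebra k V → Prop}
    (h0 : P 0) (hadd : ∀ x y, P x → P y → P (x + y))
    (hsm : ∀ (c : k) (p : QPath V), P (c • PathAlgebra.ofPath k p)) (x : PathAlgebra k V) : P x := by
  induction x using Finsupp.induction_linear with
  | zero => exact h0
  | add x y hx hy => exact hadd x y hx hy
  | single p c =>
    have h : (Finsupp.single p c : QPath V →₀ k) =
        (c • PathAlgebra.ofPath k p : PathAlgebra k V) := by
      have h1 : PathAlgebra.ofPath k p = (Finsupp.single p (1 : k) : QPath V →₀ k) :=
        congrFun Finsupp.coe_basisSingleOne p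
      rw [h1]
      exact (Finsupp.smul_single_one p c).symm
    exact h ▸ hsm c p

theorem pa_mul_add (x y z : PathAlgebra k V) : x * (y + z) = x * y + x * z := by
  simp [mul_eq_mulLin]

theorem pa_add_mul (x y z : PathAlgebra k V) : (x + y) * z = x * z + y * z := by
  simp [mul_eq_mulLin]

theorem pa_smul_mul (c : k) (x y : PathAlgebra k V) : (c • x) * y = c • (x * y) := by
  simp [mul_eq_mulLin]

theorem pa_mul_smul (c : k) (x y : PathAlgebra k V) : x * (c • y) = c • (x * y) := by
  simp [mul_eq_mulLin]

theorem pa_zero_mul (x : PathAlgebra k V) : 0 * x = 0 := by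
  simp [mul_eq_mulLin]

theorem pa_mul_zero (x : PathAlgebra k V) : x * 0 = 0 := by
  simp [mul_eq_mulLin]

theorem pa_mul_assoc (x y z : PathAlgebra k V) : x * y * z = x * (y * z) := by
  induction x using pathAlgebra_induction with
  | h0 => simp only [pa_zero_mul]
  | hadd x₁ x₂ h₁ h₂ => simp only [pa_add_mul, h₁, h₂]
  | hsm c p =>
    induction y using pathAlgebra_induction with
    | h0 => simp only [pa_zero_mul, pa_mul_zero]
    | hadd x₁ x₂ h₁ h₂ => simp only [pa_add_mul, pa_mul_add, h₁, h₂]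
    | hsm d q =>
      induction z using pathAlgebra_induction with
      | h0 => simp only [pa_mul_zero]
      | hadd x₁ x₂ h₁ h₂ => simp only [pa_mul_add, h₁, h₂]
      | hsm e r =>
        simp only [pa_smul_mul, pa_mul_smul]
        congr 3
        obtain ⟨a, b, p⟩ := p
        obtain ⟨b', c', q⟩ := q
        obtain ⟨c'', d', r⟩ := r
        by_cases h1 : b = b'
        · subst h1
          by_cases h2 : c' = c''
          · subst h2
            simp only [ofPath_mul_comp, Path.comp_assoc]
          · rw [ofPath_mul_comp, ofPath_mul_ne _ _ h2, ofPath_mul_ne _ _ h2, pa_mul_zero]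
        · rw [ofPath_mul_ne ⟨a, b, p⟩ _ h1, pa_zero_mul]
          by_cases h2 : c' = c''
          · subst h2
            rw [ofPath_mul_comp, ofPath_mul_ne _ _ h1]
          · rw [ofPath_mul_ne _ _ h2, pa_mul_zero]

variable [Fintype V]

/-- The unit is the sum of the trivial paths. -/
instance : One (PathAlgebra k V) := ⟨∑ v : V, PathAlgebra.ofPath k (trivialPath v)⟩

theorem pa_one : (1 : PathAlgebra k V) = ∑ v : V, PathAlgebra.ofPath k (trivialPath v) := rfl

theorem pa_one_mul (x : PathAlgebra k V) : 1 * x = x := by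
  induction x using pathAlgebra_induction with
  | h0 => simp only [pa_mul_zero]
  | hadd x₁ x₂ h₁ h₂ => simp only [pa_mul_add, h₁, h₂]
  | hsm c p =>
    obtain ⟨a, b, p⟩ := p
    rw [pa_mul_smul, pa_one, mul_eq_mulLin, map_sum, LinearMap.sum_apply,
      Finset.sum_eq_single a]
    · rw [← mul_eq_mulLin, trivialPath, ofPath_mul_comp, Path.nil_comp]
    · intro v _ hv
      rw [← mul_eq_mulLin, ofPath_mul_ne _ _ hv]
    · simp

theorem pa_mul_one (x : PathAlgebra k V) : x * 1 = x := by
  induction x using pathAlgebra_induction with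
  | h0 => simp only [pa_zero_mul]
  | hadd x₁ x₂ h₁ h₂ => simp only [pa_add_mul, h₁, h₂]
  | hsm c p =>
    obtain ⟨a, b, p⟩ := p
    rw [pa_smul_mul, pa_one, mul_eq_mulLin, map_sum, Finset.sum_eq_single b]
    · rw [← mul_eq_mulLin, trivialPath, ofPath_mul_comp, Path.comp_nil]
    · intro v _ hv
      rw [← mul_eq_mulLin, ofPath_mul_ne _ _ (Ne.symm hv)]
    · simp

instance : Ring (PathAlgebra k V) :=
  { (inferInstance : AddCommGroup (PathAlgebra k V)) with
    mul := (· * ·)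
    one := 1
    left_distrib := pa_mul_add
    right_distrib := pa_add_mul
    zero_mul := pa_zero_mul
    mul_zero := pa_mul_zero
    mul_assoc := pa_mul_assoc
    one_mul := pa_one_mul
    mul_one := pa_mul_one }

instance : Algebra k (PathAlgebra k V) := Algebra.ofModule pa_smul_mul pa_mul_smul

end PathAlgebra

/-! ### Quotients of path algebras, gentle algebras -/

section Gentle

variable {k V : Type*} [Field k] [Quiver V] [Fintype V]

/-- The algebra `A = k Q / I`. -/
abbrev QuotAlg (I : TwoSidedIdeal (PathAlgebra k V)) : Type _ := I.ringCon.Quotient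

/-- The projection `k Q → A`. -/
def proj (I : TwoSidedIdeal (PathAlgebra k V)) : PathAlgebra k V →ₐ[k] QuotAlg I :=
  { I.ringCon.mk' with commutes' := fun _ => rfl }

theorem proj_eq_zero_iff (I : TwoSidedIdeal (PathAlgebra k V)) (x : PathAlgebra k V) :
    proj I x = 0 ↔ x ∈ I := by
  rw [TwoSidedIdeal.mem_iff, ← RingCon.eq]; rfl

/-- The class of a path in `A`. -/
def cls (I : TwoSidedIdeal (PathAlgebra k V)) (p : QPath V) : QuotAlg I :=
  proj I (PathAlgebra.ofPath k p)

/-- The product of two arrows in the path algebra. -/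
def arrowMul (k : Type*) {V : Type*} [Field k] [Quiver V] (α β : Arrow V) : PathAlgebra k V :=
  PathAlgebra.ofPath k α.toQPath * PathAlgebra.ofPath k β.toQPath

/-- `αβ` is a path of length two which lies in `I`. -/
def IsRel (I : TwoSidedIdeal (PathAlgebra k V)) (α β : Arrow V) : Prop :=
  α.tgt = β.src ∧ arrowMul k α β ∈ I

/-- `αβ` is a path of length two which does not lie in `I`. -/
def IsNonRel (I : TwoSidedIdeal (PathAlgebra k V)) (α β : Arrow V) : Prop :=
  α.tgt = β.src ∧ arrowMul k α β ∉ I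

/-- The ideal `I` is admissible: it contains all paths of some length `m ≥ 2`, and all its elements
are combinations of paths of length at least two. -/
def IsAdmissible (I : TwoSidedIdeal (PathAlgebra k V)) : Prop :=
  (∃ m : ℕ, 2 ≤ m ∧ ∀ p : QPath V, m ≤ p.len → PathAlgebra.ofPath k p ∈ I) ∧
  ∀ x ∈ I, x ∈ Submodule.span k (PathAlgebra.ofPath k '' {p : QPath V | 2 ≤ p.len})

/-- `k Q / I` is a gentle algebra (the quiver has finitely many vertices by a standing
assumption). -/
structure IsGentle (I : TwoSidedIdeal (PathAlgebra k V)) : Prop where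
  finite_arrows : Finite (Arrow V)
  admissible : IsAdmissible I
  rel_right : ∀ α β β' : Arrow V, IsRel I α β → IsRel I α β' → β = β'
  rel_left : ∀ α γ γ' : Arrow V, IsRel I γ α → IsRel I γ' α → γ = γ'
  nonrel_right : ∀ α β β' : Arrow V, IsNonRel I α β → IsNonRel I α β' → β = β'
  nonrel_left : ∀ α γ γ' : Arrow V, IsNonRel I γ α → IsNonRel I γ' α → γ = γ'
  generated : I = TwoSidedIdeal.span {x | ∃ α β : Arrow V, IsRel I α β ∧ x = arrowMul k α β}

/-- The quiver has no oriented cycles. -/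
def NoOrientedCycles (V : Type*) [Quiver V] : Prop :=
  ∀ (a : V) (p : Path a a), p.length = 0

/-- The quiver has no parallel arrows. -/
def NoParallelArrows (V : Type*) [Quiver V] : Prop :=
  ∀ a b : V, Subsingleton (a ⟶ b)

/-- `(Q, I)` contains a subquiver of the form
```
   α₁ : x₁ → x₂,   α₂ : x₂ → x₃,   α₃ : x₃ → x₄,
   v' : x₁ ⇝ x₂,   γ₁ : x₂ → x₅,   γ₂ : x₅ → x₃,   ρ : x₅ → x₆,   δ₁ : x₃ → x₆,   d : x₆ ⇝ x₄
```
where `v'` is a path different from `α₁`, `d = δ₂ ⋯ δₛ` is a path of positive length,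
`α₁α₂` and `α₂α₃` are zero in `A`, and `v'`, `γ₁γ₂`, `δ₁δ₂ ⋯ δₛ` are nonzero in `A`. -/
def HasStar (I : TwoSidedIdeal (PathAlgebra k V)) : Prop :=
  ∃ (x₁ x₂ x₃ x₄ x₅ x₆ : V) (α₁ : x₁ ⟶ x₂) (α₂ : x₂ ⟶ x₃) (α₃ : x₃ ⟶ x₄)
    (γ₁ : x₂ ⟶ x₅) (γ₂ : x₅ ⟶ x₃) (_ρ : x₅ ⟶ x₆) (δ₁ : x₃ ⟶ x₆)
    (v' : Path x₁ x₂) (d : Path x₆ x₄),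
    v' ≠ α₁.toPath ∧ 1 ≤ v'.length ∧ 1 ≤ d.length ∧
    cls I ⟨x₁, x₃, α₁.toPath.comp α₂.toPath⟩ = 0 ∧
    cls I ⟨x₂, x₄, α₂.toPath.comp α₃.toPath⟩ = 0 ∧
    cls I ⟨x₁, x₂, v'⟩ ≠ 0 ∧
    cls I ⟨x₂, x₃, γ₁.toPath.comp γ₂.toPath⟩ ≠ 0 ∧
    cls I ⟨x₃, x₄, δ₁.toPath.comp d⟩ ≠ 0

/-- The paths which are nonzero in `A`. -/
abbrev NonzeroPath (I : TwoSidedIdeal (PathAlgebra k V)) : Type _ := {p : QPath V // cls I p ≠ 0}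

/-- The elements all of whose paths lie in `I` form a two-sided ideal. -/
def monomialPart (I : TwoSidedIdeal (PathAlgebra k V)) :
    TwoSidedIdeal (PathAlgebra k V) :=
  TwoSidedIdeal.mk'
    (Submodule.span k
      {y | ∃ p : QPath V, PathAlgebra.ofPath k p ∈ I ∧ y = PathAlgebra.ofPath k p} :
      Submodule k (PathAlgebra k V))
    (Submodule.zero_mem _) (fun hx hy => Submodule.add_mem _ hx hy)
    (by
      intro x hx
      rw [SetLike.mem_coe] at hx ⊢
      have h := Submodule.smul_mem _ (-1 : k) hx
      have h2 : (-1 : k) • x = -x := by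
        rw [eq_neg_iff_add_eq_zero]
        nth_rewrite 2 [← one_smul k x]
        rw [← add_smul, neg_add_cancel, zero_smul]
      rwa [h2] at h)
    (by
      intro x y hy
      rw [SetLike.mem_coe] at hy ⊢
      induction hy using Submodule.span_induction with
      | zero => rw [mul_zero]; exact Submodule.zero_mem _
      | add y₁ y₂ _ _ h₁ h₂ => rw [mul_add]; exact Submodule.add_mem _ h₁ h₂
      | smul c y _ h => rw [mul_smul_comm]; exact Submodule.smul_mem _ _ h
      | mem y hy =>
        obtain ⟨q, hq, rfl⟩ := hy
        induction x using pathAlgebra_induction with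
        | h0 => rw [zero_mul]; exact Submodule.zero_mem _
        | hadd x₁ x₂ h₁ h₂ => rw [add_mul]; exact Submodule.add_mem _ h₁ h₂
        | hsm c p =>
          rw [smul_mul_assoc]
          refine Submodule.smul_mem _ _ ?_
          obtain ⟨a, b, p⟩ := p
          obtain ⟨b', d, q⟩ := q
          by_cases h : b = b'
          · subst h
            refine Submodule.subset_span ⟨_, ?_, ofPath_mul_comp p q⟩
            rw [← ofPath_mul_comp]
            exact I.mul_mem_left _ _ hq
          · rw [ofPath_mul_ne _ _ h]; exact Submodule.zero_mem _)
    (by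
      intro y x hy
      rw [SetLike.mem_coe] at hy ⊢
      induction hy using Submodule.span_induction with
      | zero => rw [zero_mul]; exact Submodule.zero_mem _
      | add y₁ y₂ _ _ h₁ h₂ => rw [add_mul]; exact Submodule.add_mem _ h₁ h₂
      | smul c y _ h => rw [smul_mul_assoc]; exact Submodule.smul_mem _ _ h
      | mem y hy =>
        obtain ⟨q, hq, rfl⟩ := hy
        induction x using pathAlgebra_induction with
        | h0 => rw [mul_zero]; exact Submodule.zero_mem _
        | hadd x₁ x₂ h₁ h₂ => rw [mul_add]; exact Submodule.add_mem _ h₁ h₂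
        | hsm c p =>
          rw [mul_smul_comm]
          refine Submodule.smul_mem _ _ ?_
          obtain ⟨a, b, p⟩ := p
          obtain ⟨b', d, q⟩ := q
          by_cases h : d = a
          · subst h
            refine Submodule.subset_span ⟨_, ?_, ofPath_mul_comp q p⟩
            rw [← ofPath_mul_comp]
            exact I.mul_mem_right _ _ hq
          · rw [ofPath_mul_ne _ _ h]; exact Submodule.zero_mem _)

theorem ofPath_arrow_mul (k : Type*) {V : Type*} [Field k] [Quiver V] {a b c : V}
    (α : a ⟶ b) (β : b ⟶ c) :
    arrowMul k ⟨a, b, α⟩ ⟨b, c, β⟩ = PathAlgebra.ofPath k ⟨a, c, α.toPath.comp β.toPath⟩ :=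
  ofPath_mul_comp _ _

/-- The paths occurring in an element of the ideal of a gentle algebra lie in the ideal. -/
theorem IsGentle.support_mem {I : TwoSidedIdeal (PathAlgebra k V)} (hI : IsGentle I)
    {x : PathAlgebra k V} (hx : x ∈ I) (p : QPath V)
    (hp : (PathAlgebra.basis k V).repr x p ≠ 0) : PathAlgebra.ofPath k p ∈ I := by
  have hx' : x ∈ monomialPart I := by
    rw [hI.generated, TwoSidedIdeal.mem_span_iff] at hx
    refine hx _ ?_
    rintro y ⟨⟨a, b, α⟩, ⟨b', c, β⟩, ⟨hc, hm⟩, rfl⟩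
    obtain rfl : b = b' := hc
    rw [ofPath_arrow_mul] at hm ⊢
    rw [SetLike.mem_coe, monomialPart, TwoSidedIdeal.mem_mk']
    exact Submodule.subset_span ⟨_, hm, rfl⟩
  rw [monomialPart, TwoSidedIdeal.mem_mk', SetLike.mem_coe] at hx'
  by_contra hpI
  refine hp ?_
  clear hp hx
  induction hx' using Submodule.span_induction with
  | zero => simp
  | add y₁ y₂ _ _ h₁ h₂ => simp [h₁, h₂]
  | smul c y _ h => simp [h]
  | mem y hy =>
    obtain ⟨q, hq, rfl⟩ := hy
    rw [PathAlgebra.ofPath, Module.Basis.repr_self, Finsupp.single_apply, if_neg]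
    rintro rfl
    exact hpI hq

theorem IsGentle.linearIndependent {I : TwoSidedIdeal (PathAlgebra k V)} (hI : IsGentle I) :
    LinearIndependent k (fun p : NonzeroPath I => cls I p.1) := by
  rw [linearIndependent_iff]
  intro l hl
  have h1 : proj I (Finsupp.linearCombination k
      (fun p : NonzeroPath I => PathAlgebra.ofPath k p.1) l) = 0 := by
    refine Eq.trans ?_ hl
    rw [Finsupp.linearCombination_apply, Finsupp.linearCombination_apply, Finsupp.sum,
      Finsupp.sum, map_sum]
    simp only [map_smul]
    rfl
  rw [proj_eq_zero_iff] at h1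
  ext p
  by_contra hne
  refine p.2 ((proj_eq_zero_iff I _).2 (hI.support_mem h1 p.1 ?_))
  have h2 : Finsupp.linearCombination k (fun p : NonzeroPath I => PathAlgebra.ofPath k p.1) l =
      Finsupp.linearCombination k (PathAlgebra.basis k V) (l.mapDomain Subtype.val) := by
    rw [Finsupp.linearCombination_mapDomain]; rfl
  rw [h2, Module.Basis.repr_linearCombination, Finsupp.mapDomain_apply Subtype.val_injective]
  exact hne

theorem span_cls (I : TwoSidedIdeal (PathAlgebra k V)) :
    ⊤ ≤ Submodule.span k (Set.range (fun p : NonzeroPath I => cls I p.1)) := by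
  rintro x -
  obtain ⟨x, rfl⟩ := I.ringCon.mk'_surjective x
  change proj I x ∈ _
  induction x using pathAlgebra_induction with
  | h0 => rw [map_zero]; exact Submodule.zero_mem _
  | hadd x₁ x₂ h₁ h₂ => rw [map_add]; exact Submodule.add_mem _ h₁ h₂
  | hsm c p =>
    rw [map_smul]
    refine Submodule.smul_mem _ _ ?_
    by_cases h : cls I p = 0
    · change cls I p ∈ _
      rw [h]; exact Submodule.zero_mem _
    · exact Submodule.subset_span ⟨⟨p, h⟩, rfl⟩

/-- The nonzero paths form a basis of a gentle algebra. -/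
def IsGentle.pathBasis {I : TwoSidedIdeal (PathAlgebra k V)} (hI : IsGentle I) :
    Module.Basis (NonzeroPath I) k (QuotAlg I) :=
  Module.Basis.mk hI.linearIndependent (span_cls I)

end Gentle

/-! ### Bardzell cochains, comparison maps and Hochschild cochains

`A`-bimodule maps out of a free bimodule `A ⊗ W ⊗ A` are given by their values on `1 ⊗ w ⊗ 1`, so a
comparison map `A ⊗ W ⊗ A → A ⊗ W' ⊗ A` is recorded as a linear map `W → A ⊗ W' ⊗ A`. -/

section Cochains

variable {k V : Type*} [Field k] [Quiver V] [Fintype V]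

/-- `AP₂`: the pairs of arrows `(α₁, α₂)` with `α₁α₂ = 0` in `A`. -/
abbrev AP2 (I : TwoSidedIdeal (PathAlgebra k V)) : Type _ :=
  {ω : Arrow V × Arrow V // IsRel I ω.1 ω.2}

/-- `AP₃`: the triples of arrows `(α₁, α₂, α₃)` with `α₁α₂ = 0` and `α₂α₃ = 0` in `A`. -/
abbrev AP3 (I : TwoSidedIdeal (PathAlgebra k V)) : Type _ :=
  {ω : Arrow V × Arrow V × Arrow V // IsRel I ω.1 ω.2.1 ∧ IsRel I ω.2.1 ω.2.2}

/-- `B¹(A)[1] = Hom_{E-E}(k AP₂, A)`, where `E` is spanned by the trivial paths: families of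
elements `f(α₁, α₂)` of `e A e'`, with `e` and `e'` the trivial paths at the source of `α₁` and at
the target of `α₂`. -/
def BardzellOne (I : TwoSidedIdeal (PathAlgebra k V)) : Submodule k (AP2 I → QuotAlg I) where
  carrier := {f | ∀ ω : AP2 I,
    cls I (trivialPath ω.1.1.src) * f ω * cls I (trivialPath ω.1.2.tgt) = f ω}
  zero_mem' := fun ω => by simp
  add_mem' := fun {f g} hf hg ω => by
    rw [Pi.add_apply, mul_add, add_mul, hf ω, hg ω]
  smul_mem' := fun c f hf ω => by
    rw [Pi.smul_apply, mul_smul_comm, smul_mul_assoc, hf ω]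

/-- The Bardzell differential `δ²` on `Hom_{E-E}(k AP₂, A)`:
`δ²(f)(α₁, α₂, α₃) = α₁ f(α₂, α₃) - f(α₁, α₂) α₃`. -/
def delta2 {I : TwoSidedIdeal (PathAlgebra k V)} (f : BardzellOne I) (ω : AP3 I) : QuotAlg I :=
  cls I ω.1.1.toQPath * f.1 ⟨(ω.1.2.1, ω.1.2.2), ω.2.2⟩ -
    f.1 ⟨(ω.1.1, ω.1.2.1), ω.2.1⟩ * cls I ω.1.2.2.toQPath

/-- `f` is a `2`-cocycle of the Bardzell complex. -/
def IsTwoCocycle {I : TwoSidedIdeal (PathAlgebra k V)} (f : BardzellOne I) : Prop :=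
  ∀ ω : AP3 I, delta2 f ω = 0

/-- The bimodule map `A ⊗ W ⊗ A → A`, `a ⊗ w ⊗ b ↦ a g(w) b`, extending a linear map `g`. -/
def hat (I : TwoSidedIdeal (PathAlgebra k V)) {W : Type*} [AddCommGroup W] [Module k W]
    (g : W →ₗ[k] QuotAlg I) : QuotAlg I ⊗[k] (W ⊗[k] QuotAlg I) →ₗ[k] QuotAlg I :=
  LinearMap.mul' k (QuotAlg I) ∘ₗ
    LinearMap.lTensor (QuotAlg I) (LinearMap.mul' k (QuotAlg I) ∘ₗ LinearMap.rTensor (QuotAlg I) g)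

/-- The value of `G₂` on `1 ⊗ u ⊗ v ⊗ 1`, for paths `u` and `v`: it is
`u' ⊗ (α₁, α₂) ⊗ v'` if `u = u' α₁`, `v = α₂ v'` with `α₁α₂ = 0` in `A`, and zero otherwise. -/
def G2path (I : TwoSidedIdeal (PathAlgebra k V)) (u v : QPath V) :
    QuotAlg I ⊗[k] ((AP2 I →₀ k) ⊗[k] QuotAlg I) :=
  match u.splits.getLast?, v.splits.head? with
  | some x, some y =>
      if h : IsRel I x.2.1 y.2.1 then
        cls I x.1 ⊗ₜ[k] (Finsupp.single ⟨(x.2.1, y.2.1), h⟩ 1 ⊗ₜ[k] cls I y.2.2)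
      else 0
  | _, _ => 0

/-- The value of the homotopy `H₂` on `1 ⊗ u ⊗ v ⊗ 1`, for paths `u = β₁ ⋯ βₘ` and
`v = γ₁ ⋯ γᵣ`: it is
`Θ(βₘ, γ₁) 1 ⊗ β₁ ⋯ βₘ₋₁ ⊗ βₘ ⊗ γ₁ ⊗ γ₂ ⋯ γᵣ - ∑_{i = 2}^r 1 ⊗ u ⊗ γ₁ ⋯ γᵢ₋₁ ⊗ γᵢ ⊗ γᵢ₊₁ ⋯ γᵣ`,
with `Θ(βₘ, γ₁) = 1` if `βₘγ₁ = 0` in `A` and zero otherwise. It is zero if one of the paths is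
trivial. -/
def H2path (I : TwoSidedIdeal (PathAlgebra k V)) (u v : QPath V) :
    QuotAlg I ⊗[k] ((QuotAlg I ⊗[k] (QuotAlg I ⊗[k] QuotAlg I)) ⊗[k] QuotAlg I) :=
  match u.splits.getLast?, v.splits.head? with
  | some x, some y =>
      (if IsRel I x.2.1 y.2.1 then
        1 ⊗ₜ[k] ((cls I x.1 ⊗ₜ[k] (cls I x.2.1.toQPath ⊗ₜ[k] cls I y.2.1.toQPath)) ⊗ₜ[k]
          cls I y.2.2)
      else 0) -
      (v.splits.tail.map (fun z =>
        (1 : QuotAlg I) ⊗ₜ[k] ((cls I u ⊗ₜ[k] (cls I z.1 ⊗ₜ[k] cls I z.2.1.toQPath)) ⊗ₜ[k]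
          cls I z.2.2))).sum
  | _, _ => 0

variable {I : TwoSidedIdeal (PathAlgebra k V)} (hI : IsGentle I)

/-- The comparison map `G₂` (restricted to `A ⊗ A ≅ 1 ⊗ A ⊗ A ⊗ 1`). -/
def G2 : QuotAlg I ⊗[k] QuotAlg I →ₗ[k] QuotAlg I ⊗[k] ((AP2 I →₀ k) ⊗[k] QuotAlg I) :=
  (hI.pathBasis.tensorProduct hI.pathBasis).constr k fun p => G2path I p.1.1 p.2.1

/-- The homotopy `H₂` (restricted to `A ⊗ A ≅ 1 ⊗ A ⊗ A ⊗ 1`). -/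
def H2 : QuotAlg I ⊗[k] QuotAlg I →ₗ[k]
    QuotAlg I ⊗[k] ((QuotAlg I ⊗[k] (QuotAlg I ⊗[k] QuotAlg I)) ⊗[k] QuotAlg I) :=
  (hI.pathBasis.tensorProduct hI.pathBasis).constr k fun p => H2path I p.1.1 p.2.1

/-- The value of the comparison map `F₃` on `1 ⊗ (α₁, α₂, α₃) ⊗ 1`. -/
def F3 (ω : AP3 I) :
    QuotAlg I ⊗[k] ((QuotAlg I ⊗[k] (QuotAlg I ⊗[k] QuotAlg I)) ⊗[k] QuotAlg I) :=
  1 ⊗ₜ[k] ((cls I ω.1.1.toQPath ⊗ₜ[k] (cls I ω.1.2.1.toQPath ⊗ₜ[k] cls I ω.1.2.2.toQPath)) ⊗ₜ[k] 1)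

/-- Hochschild `2`-cochains, the degree one part of the shifted Hochschild complex. -/
abbrev HochTwo (I : TwoSidedIdeal (PathAlgebra k V)) : Type _ :=
  QuotAlg I ⊗[k] QuotAlg I →ₗ[k] QuotAlg I

/-- Hochschild `3`-cochains, the degree two part of the shifted Hochschild complex. -/
abbrev HochThree (I : TwoSidedIdeal (PathAlgebra k V)) : Type _ :=
  QuotAlg I ⊗[k] (QuotAlg I ⊗[k] QuotAlg I) →ₗ[k] QuotAlg I

/-- The Gerstenhaber product `f (g ⊗ Id - Id ⊗ g)` of Hochschild `2`-cochains. -/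
def circ (f g : HochTwo I) : HochThree I :=
  f ∘ₗ (LinearMap.rTensor (QuotAlg I) g ∘ₗ
      (TensorProduct.assoc k (QuotAlg I) (QuotAlg I) (QuotAlg I)).symm.toLinearMap -
    LinearMap.lTensor (QuotAlg I) g)

/-- The Gerstenhaber bracket of Hochschild `2`-cochains,
`[f, g] = f (g ⊗ Id - Id ⊗ g) + g (f ⊗ Id - Id ⊗ f)`. -/
def bracket (f g : HochTwo I) : HochThree I := circ f g + circ g f

/-- `G^*` on `B¹(A)[1]`. -/
def GStar (f : BardzellOne I) : HochTwo I :=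
  hat I (Finsupp.linearCombination k f.1) ∘ₗ G2 hI

/-- `H^*` on Hochschild `3`-cochains. -/
def HStar (v : HochThree I) : HochTwo I := hat I v ∘ₗ H2 hI

/-- `F^*` on Hochschild `3`-cochains. -/
def FStar (v : HochThree I) (ω : AP3 I) : QuotAlg I := hat I v (F3 ω)

end Cochains

/-! ### The brackets and the Maurer-Cartan equation -/

section Brackets

/-- The set `S⁻_{t, n-t}` of those `(t, n-t)`-shuffles `τ` of `n` letters for which the first letter
of the first block is smaller than the first letter of the second block. -/
def shuffles (n t : ℕ) : Finset (Equiv.Perm (Fin n)) :=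
  Finset.univ.filter fun τ =>
    (∀ i j : Fin n, i < j → j.val < t → τ i < τ j) ∧
    (∀ i j : Fin n, i < j → t ≤ i.val → τ i < τ j) ∧
    (∀ i j : Fin n, i.val = 0 → j.val = t → τ i < τ j)

variable {k V : Type*} [Field k] [Quiver V] [Fintype V]
variable {I : TwoSidedIdeal (PathAlgebra k V)} (hI : IsGentle I)

mutual

/-- `vₙ = ∑_{t = 1}^{n-1} ∑_{τ ∈ S⁻_{t,n-t}} χ(τ) κ(τ)_t [φ_t, φ_{n-t}] τ̂` on arguments of
degree one, with `v₀ = v₁ = 0`. For such arguments the antisymmetric Koszul sign is `χ(τ) = 1`, and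
`κ(τ)_t = (-1)^{(t-1) + (n-t-1) ∑_{p ≤ t} |f_{τ(p)}|} = (-1)^{(t-1) + (n-t-1) t}`.
Here `n = m + 2` and `t = s + 1`. -/
def vMap : (n : ℕ) → (Fin n → BardzellOne I) → HochThree I
  | 0, _ => 0
  | 1, _ => 0
  | m + 2, f =>
      ∑ s : Fin (m + 1), ∑ τ ∈ shuffles (m + 2) (s.val + 1),
        ((-1 : k) ^ (s.val + (m - s.val) * (s.val + 1))) •
          bracket
            (phiMap (s.val + 1) fun i => f (τ ⟨i.val, by omega⟩))
            (phiMap (m + 1 - s.val) fun i => f (τ ⟨s.val + 1 + i.val, by omega⟩))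
  termination_by n => (n, 0)
  decreasing_by
    all_goals simp_wf
    all_goals omega

/-- `φ₁ = G^*` and `φₙ = H^* vₙ` for `n ≥ 2`, on arguments of degree one. -/
def phiMap : (n : ℕ) → (Fin n → BardzellOne I) → HochTwo I
  | 0, _ => 0
  | 1, f => GStar hI (f 0)
  | m + 2, f => HStar hI (vMap (m + 2) f)
  termination_by n => (n, 1)

end

/-- The brackets of the `L_∞`-structure of `B(A)[1]` on elements of `B¹(A)[1]`: `l₁ = -δ²` and
`lₙ = F^* vₙ` for `n ≥ 2`; their values are functions on `AP₃`. -/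
def lMap : (n : ℕ) → (Fin n → BardzellOne I) → AP3 I → QuotAlg I
  | 0, _ => 0
  | 1, f => fun ω => -delta2 (f 0) ω
  | m + 2, f => fun ω => FStar (vMap hI (m + 2) f) ω

/-- The coefficient of `t^i` in `lₙ(F, …, F)`, for `F = ∑_{j ≥ 1} f_j t^j`, that is, the sum of
`lₙ(f_{j₁}, …, f_{jₙ})` over all `j₁ + ⋯ + jₙ = i` with all `j_a ≥ 1`. -/
def lCoeff (f : ℕ → BardzellOne I) (n i : ℕ) (ω : AP3 I) : QuotAlg I :=
  ∑ j ∈ (Finset.Nat.antidiagonalTuple n i).filter (fun j => ∀ a, 1 ≤ j a),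
    lMap hI n (fun a => f (j a)) ω

/-- The series `F = ∑_{i ≥ 1} f_i t^i` with `f_i ∈ B¹(A)[1]` satisfies the generalized Maurer-Cartan
equation `l₁(F) - ∑_{n ≥ 2} (-1)^{n(n+1)/2} lₙ(F, …, F) / n! = 0`, coefficientwise in `t` (terms with
`n > i` do not contribute to the coefficient of `t^i`, as `F` has no constant term; the value `f 0`
is not used). -/
def IsMaurerCartan (f : ℕ → BardzellOne I) : Prop :=
  ∀ i : ℕ, 1 ≤ i → ∀ ω : AP3 I,
    lCoeff hI f 1 i ω -
      ∑ n ∈ Finset.Icc 2 i,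
        ((-1 : k) ^ ((n + 1) * n / 2) * (n.factorial : k)⁻¹) • lCoeff hI f n i ω = 0

end Brackets

end GentleMC

end

noncomputable section

namespace GentleMC

open Quiver TensorProduct
open scoped Classical

/-! ### Words of arrows in a gentle bound quiver -/

-- The proof is an induction on the power of `t`. In the coefficient of `t^i` the brackets `lₙ` with
-- `n ≥ 2` only see the `f_j` with `j < i`. If these are cocycles and the higher brackets vanish on
-- cocycles, what remains of the equation is `-δ²(f_i) = 0`. Both directions therefore rest on
-- `lMap_eq_zero`: for `n ≥ 2` the bracket `lₙ` vanishes on cocycles.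
--
-- Gentleness restricts the values of a cocycle. Comparing coefficients in the cocycle identity on
-- an overlap (`IsTwoCocycle.mem_span`) shows that `f(s, y)` is a combination of nonzero paths
-- parallel to `s y` which start with `s` or end with `y`, unless `s y` overlaps no other relation.
-- This is the predicate `Perm`. Evaluating cocycles thus becomes a rewriting of words of arrows, in
-- which the leftmost relation is replaced by a permitted path. By `supported_phiMap`, `φₙ(u ⊗ v)`
-- is a combination of paths obtained from the word `u v` by exactly `n` replacements, and a word
-- without relations admits none.
--
-- On an overlap `α₁ α₂ α₃` the bracket is built from the terms `φₘ(φᵣ(α₁ ⊗ α₂) ⊗ α₃)` and `φₘ(α₁ ⊗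
-- φᵣ(α₂ ⊗ α₃))`. Replacing a single relation gives a path without relations, so only `r = 1`
-- contributes. For `m = r = 1` the four terms of the Gerstenhaber bracket cancel in pairs
-- (`bracket_GStar`). For `m ≥ 2` a path without relations would have to be reached from `z α₃`, or
-- from `α₁ z`, by at least two replacements; `left_not_reach` and `right_not_reach` exclude this.
-- Both follow an invariant of the words that is incompatible with being free of relations: on the
-- left, a vertex off a prescribed path; on the right, the first two arrows together with an
-- intermediate vertex.

/-- The combinatorial data of a gentle bound quiver without oriented cycles and parallel arrows:
a set `X` of arrows, with the pairs of composable arrows divided into relations and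
non-relations. -/
structure BoundQuiver (X V : Type*) where
  src : X → V
  tgt : X → V
  Rel : X → X → Prop
  Non : X → X → Prop
  /-- There is a path between two vertices. -/
  Conn : V → V → Prop
  conn_refl : ∀ v, Conn v v
  conn_trans : ∀ {u v w}, Conn u v → Conn v w → Conn u w
  conn_arrow : ∀ a, Conn (src a) (tgt a)
  not_conn : ∀ a, ¬ Conn (tgt a) (src a)
  rel_comp : ∀ {a b}, Rel a b → tgt a = src b
  non_comp : ∀ {a b}, Non a b → tgt a = src b
  rel_or_non : ∀ {a b}, tgt a = src b → Rel a b ∨ Non a b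
  rel_not_non : ∀ {a b}, Rel a b → ¬ Non a b
  rel_right : ∀ {a b b'}, Rel a b → Rel a b' → b = b'
  rel_left : ∀ {a c c'}, Rel c a → Rel c' a → c = c'
  non_right : ∀ {a b b'}, Non a b → Non a b' → b = b'
  non_left : ∀ {a c c'}, Non c a → Non c' a → c = c'
  parallel : ∀ {a b}, src a = src b → tgt a = tgt b → a = b

namespace BoundQuiver

variable {X V : Type*} (B : BoundQuiver X V)

/-- `L` is a path from `a` to `b`. -/
def Walk : V → List X → V → Prop
  | a, [], b => a = b
  | a, x :: L, b => B.src x = a ∧ Walk (B.tgt x) L b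

/-- No two consecutive arrows of `L` form a relation. -/
def NZ (L : List X) : Prop := L.IsChain B.Non

/-- `z` is a path parallel to the relation `s y`, not containing a relation, which may occur in the
value of a cocycle on `s y`: it starts with `s`, or ends with `y`, or `s y` is not part of an
overlap of relations. -/
def Perm (s y : X) (z : List X) : Prop :=
  z ≠ [] ∧ B.NZ z ∧ B.Walk (B.src s) z (B.tgt y) ∧
    ((∃ t, z = s :: t) ∨ (∃ t, z = t ++ [y]) ∨
      ((∀ d, ¬ B.Rel y d) ∧ ∀ c, ¬ B.Rel c s))

/-- Replacement of the leftmost relation `s y` of a word. -/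
def Step (w w' : List X) : Prop :=
  ∃ p s y z r, w = p ++ s :: y :: r ∧ w' = p ++ (z ++ r) ∧ B.NZ (p ++ [s]) ∧ B.Rel s y ∧
    B.Perm s y z

/-- `w'` is obtained from `w` by `n` replacements. -/
def Reach : ℕ → List X → List X → Prop
  | 0, w, w' => w = w'
  | n + 1, w, w' => ∃ w₁, B.Step w w₁ ∧ Reach n w₁ w'

variable {B}

@[simp] theorem walk_nil {a b : V} : B.Walk a [] b ↔ a = b := Iff.rfl

@[simp] theorem walk_cons {a b : V} {x : X} {L : List X} :
    B.Walk a (x :: L) b ↔ B.src x = a ∧ B.Walk (B.tgt x) L b := Iff.rfl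

theorem walk_append {L M : List X} {a b : V} :
    B.Walk a (L ++ M) b ↔ ∃ c, B.Walk a L c ∧ B.Walk c M b := by
  induction L generalizing a with
  | nil => simp
  | cons x L ih => simp [ih, and_assoc]

theorem walk_concat {L : List X} {x : X} {a b : V} :
    B.Walk a (L ++ [x]) b ↔ B.Walk a L (B.src x) ∧ B.tgt x = b := by
  rw [walk_append]
  constructor
  · rintro ⟨c, h, rfl, h'⟩; exact ⟨h, h'⟩
  · rintro ⟨h, h'⟩; exact ⟨_, h, rfl, h'⟩

theorem Walk.conn {L : List X} {a b : V} (h : B.Walk a L b) : B.Conn a b := by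
  induction L generalizing a with
  | nil => cases h; exact B.conn_refl _
  | cons x L ih =>
    obtain ⟨rfl, h⟩ := h
    exact B.conn_trans (B.conn_arrow x) (ih h)

theorem Walk.eq_nil {L : List X} {a : V} (h : B.Walk a L a) : L = [] := by
  cases L with
  | nil => rfl
  | cons x L =>
    obtain ⟨rfl, h⟩ := h
    exact (B.not_conn x h.conn).elim

/-- A nonempty walk and a way back would form an oriented cycle. Many of the contradictions in the
two overlap arguments arise in this way. -/
theorem Walk.eq_nil_of_conn {L : List X} {a b : V} (h : B.Walk a L b) (hc : B.Conn b a) :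
    L = [] := by
  cases L with
  | nil => rfl
  | cons x L =>
    obtain ⟨rfl, h⟩ := h
    exact (B.not_conn x (B.conn_trans h.conn hc)).elim

theorem src_ne_tgt (a : X) : B.src a ≠ B.tgt a := fun h =>
  B.not_conn a (h ▸ B.conn_refl _)

theorem non_of_not_rel {a b : X} (h : B.tgt a = B.src b) (hr : ¬ B.Rel a b) : B.Non a b :=
  (B.rel_or_non h).resolve_left hr

theorem rel_of_not_non {a b : X} (h : B.tgt a = B.src b) (hr : ¬ B.Non a b) : B.Rel a b :=
  (B.rel_or_non h).resolve_right hr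

@[simp] theorem nz_nil : B.NZ [] := .nil
@[simp] theorem nz_singleton (a : X) : B.NZ [a] := .singleton _
@[simp] theorem nz_cons_cons {a b : X} {L : List X} :
    B.NZ (a :: b :: L) ↔ B.Non a b ∧ B.NZ (b :: L) := List.isChain_cons_cons

theorem NZ.left {L M : List X} (h : B.NZ (L ++ M)) : B.NZ L := List.IsChain.left_of_append h
theorem NZ.right {L M : List X} (h : B.NZ (L ++ M)) : B.NZ M := List.IsChain.right_of_append h
theorem NZ.tail {a : X} {L : List X} (h : B.NZ (a :: L)) : B.NZ L := List.IsChain.tail h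

theorem nz_split {L M : List X} {a b : X} :
    B.NZ (L ++ a :: b :: M) ↔ B.NZ (L ++ [a]) ∧ B.Non a b ∧ B.NZ (b :: M) :=
  List.isChain_append_cons_cons

theorem nz_glue {L M : List X} {a : X} : B.NZ (L ++ a :: M) ↔ B.NZ (L ++ [a]) ∧ B.NZ (a :: M) :=
  List.isChain_split

theorem NZ.not_step {w w' : List X} (h : B.NZ w) : ¬ B.Step w w' := by
  rintro ⟨p, s, y, z, r, rfl, -, -, hr, -⟩
  exact B.rel_not_non hr (nz_split.1 h).2.1

theorem NZ.not_reach {w w' : List X} (h : B.NZ w) {n : ℕ} (hn : n ≠ 0) : ¬ B.Reach n w w' := by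
  cases n with
  | zero => exact (hn rfl).elim
  | succ n => rintro ⟨w₁, hs, -⟩; exact h.not_step hs

theorem Reach.trans {m n : ℕ} {w w' w'' : List X} (h : B.Reach m w w') (h' : B.Reach n w' w'') :
    B.Reach (m + n) w w'' := by
  induction m generalizing w with
  | zero => obtain rfl : w = w' := h; rwa [Nat.zero_add]
  | succ m ih =>
    obtain ⟨w₁, hs, hr⟩ := h
    rw [Nat.succ_add]
    exact ⟨w₁, hs, ih hr⟩

/-- Being the leftmost relation is a condition on what stands to the left, so a suffix does not
disturb it. A prefix could. -/
theorem Step.append_right {w w' : List X} (h : B.Step w w') (M : List X) :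
    B.Step (w ++ M) (w' ++ M) := by
  obtain ⟨p, s, y, z, r, rfl, rfl, h⟩ := h
  exact ⟨p, s, y, z, r ++ M, by simp, by simp, h⟩

theorem Reach.append_right {n : ℕ} {w w' : List X} (h : B.Reach n w w') (M : List X) :
    B.Reach n (w ++ M) (w' ++ M) := by
  induction n generalizing w with
  | zero => obtain rfl : w = w' := h; rfl
  | succ n ih =>
    obtain ⟨w₁, hs, hr⟩ := h
    exact ⟨_, hs.append_right M, ih hr⟩

/-- If one of `p`, `p'` were shorter, its relation would lie inside the other relation-free initial
part. -/
theorem leftmost_unique {p p' r r' : List X} {s s' y y' : X}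
    (h : p ++ s :: y :: r = p' ++ s' :: y' :: r') (hp : B.NZ (p ++ [s])) (hr : B.Rel s y)
    (hp' : B.NZ (p' ++ [s'])) (hr' : B.Rel s' y') : p = p' ∧ s = s' ∧ y = y' ∧ r = r' := by
  induction p generalizing p' with
  | nil =>
    rcases p' with _ | ⟨a, _ | ⟨b, p'⟩⟩
    · simpa using h
    · simp only [List.nil_append, List.cons_append, List.cons.injEq] at h
      obtain ⟨rfl, rfl, -⟩ := h
      simp only [List.cons_append, List.nil_append, nz_cons_cons] at hp'
      exact (B.rel_not_non hr hp'.1).elim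
    · simp only [List.nil_append, List.cons_append, List.cons.injEq] at h
      obtain ⟨rfl, rfl, -⟩ := h
      simp only [List.cons_append, nz_cons_cons] at hp'
      exact (B.rel_not_non hr hp'.1).elim
  | cons a p ih =>
    rcases p' with _ | ⟨a', p'⟩
    · rcases p with _ | ⟨b, p⟩
      · simp only [List.nil_append, List.cons_append, List.cons.injEq] at h
        obtain ⟨rfl, rfl, -⟩ := h
        simp only [List.cons_append, List.nil_append, nz_cons_cons] at hp
        exact (B.rel_not_non hr' hp.1).elim
      · simp only [List.nil_append, List.cons_append, List.cons.injEq] at h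
        obtain ⟨rfl, rfl, -⟩ := h
        simp only [List.cons_append, nz_cons_cons] at hp
        exact (B.rel_not_non hr' hp.1).elim
    · simp only [List.cons_append, List.cons.injEq] at h
      obtain ⟨rfl, h⟩ := h
      obtain ⟨rfl, h'⟩ := ih h hp.tail hp'.tail
      exact ⟨rfl, h'⟩

/-- A word with a relation right after a nonzero part can be changed there only. -/
theorem Step.eq_of_leftmost {p r w' : List X} {s y : X} (h : B.Step (p ++ s :: y :: r) w')
    (hp : B.NZ (p ++ [s])) (hr : B.Rel s y) : ∃ z, w' = p ++ (z ++ r) ∧ B.Perm s y z := by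
  obtain ⟨p', s', y', z, r', h1, rfl, hp', hr', hz⟩ := h
  obtain ⟨rfl, rfl, rfl, rfl⟩ := leftmost_unique h1 hp hr hp' hr'
  exact ⟨z, rfl, hz⟩

/-- A path not containing relations is determined by its last arrow and its source. -/
theorem NZ.eq_of_last {L M : List X} {x : X} {a : V} (hL : B.NZ (L ++ [x])) (hM : B.NZ (M ++ [x]))
    (wL : B.Walk a L (B.src x)) (wM : B.Walk a M (B.src x)) : L = M := by
  induction L using List.reverseRecOn generalizing M x with
  | nil =>
    cases wL
    exact wM.eq_nil.symm
  | append_singleton L b ih =>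
    rcases List.eq_nil_or_concat M with rfl | ⟨M, c, rfl⟩
    · cases wM
      exact wL.eq_nil
    · simp only [List.concat_eq_append] at *
      have h1 : B.NZ (L ++ b :: x :: []) := by simpa using hL
      have h2 : B.NZ (M ++ c :: x :: []) := by simpa using hM
      rw [nz_split] at h1 h2
      obtain rfl := B.non_left h1.2.1 h2.2.1
      rw [ih h1.1 h2.1 (walk_concat.1 wL).1 (walk_concat.1 wM).1]

/-- Of two paths not containing relations with the same first arrow, one is an initial part of the
other. -/
theorem NZ.prefix_or {L M : List X} {x : X} (hL : B.NZ (x :: L)) (hM : B.NZ (x :: M)) :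
    (∃ T, M = L ++ T) ∨ ∃ T, L = M ++ T := by
  induction L generalizing M x with
  | nil => exact .inl ⟨M, rfl⟩
  | cons a L ih =>
    rcases M with _ | ⟨b, M⟩
    · exact .inr ⟨_, rfl⟩
    · rw [nz_cons_cons] at hL hM
      obtain rfl := B.non_right hL.1 hM.1
      rcases ih hL.2 hM.2 with ⟨T, rfl⟩ | ⟨T, rfl⟩
      · exact .inl ⟨T, rfl⟩
      · exact .inr ⟨T, rfl⟩

/-- The first replacement already yields a word without relations, where the process stops. -/
theorem Perm.reach_one {s y : X} {z : List X} {n : ℕ} (hr : B.Rel s y)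
    (h : B.Reach n [s, y] z) (hn : n ≠ 0) (hz : B.NZ z) : n = 1 ∧ B.Perm s y z := by
  obtain _ | n := n
  · exact (hn rfl).elim
  obtain ⟨w, hs, h⟩ := h
  obtain ⟨z', rfl, hp⟩ := Step.eq_of_leftmost (p := []) (r := []) hs (by simp) hr
  simp only [List.nil_append, List.append_nil] at h
  obtain _ | n := n
  · obtain rfl : z' = z := h
    exact ⟨rfl, hp⟩
  · exact (NZ.not_reach hp.2.1 (by simp) h).elim

theorem Walk.unique {L : List X} {a b c : V} (h : B.Walk a L b) (h' : B.Walk a L c) : b = c := by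
  induction L generalizing a with
  | nil => exact h.symm.trans h'
  | cons x L ih => exact ih h.2 h'.2

/-! ### The overlap `α₁ α₂ α₃` -/

variable {α₁ α₂ α₃ : X}

/-- The words which are dealt with in `left_not_reach`: paths `r α₃` where `r` leaves the vertices
of `x`, and also those of `u` if `α₂` can be prolonged to a path not containing relations. -/
def LeftInv (α₁ α₂ α₃ : X) (u x w : List X) : Prop :=
  ∃ r, w = r ++ [α₃] ∧ B.Walk (B.src α₁) r (B.tgt α₂) ∧
    (¬ ∀ a ∈ r, B.tgt a = B.tgt α₂ ∨ ∃ b ∈ x, B.tgt a = B.src b) ∧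
    ((∃ v, B.Non α₂ v) → ¬ ∀ a ∈ r, B.tgt a = B.tgt α₂ ∨ ∃ b ∈ u, B.tgt a = B.tgt b)

/-- A replacement that begins with `s` or ends with `y` still passes through the middle vertex `tgt
s = src y`. If the vertices reached by `z` lie in `S` and the middle vertex does not, only the
isolated alternative of `Perm` survives. -/
theorem Perm.avoid {s y : X} {z : List X} (hz : B.Perm s y z) {S : V → Prop}
    (hs : ¬ S (B.tgt s)) (hsy : B.tgt s = B.src y) (hS : ∀ a ∈ z, S (B.tgt a)) :
    (∀ d, ¬ B.Rel y d) ∧ ∀ c, ¬ B.Rel c s := by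
  obtain ⟨-, -, hw, ⟨t, rfl⟩ | ⟨t, rfl⟩ | h⟩ := hz
  · exact (hs (hS s (by simp))).elim
  · rcases List.eq_nil_or_concat t with rfl | ⟨t, c, rfl⟩
    · have h1 : B.src y = B.src s := hw.1
      exact (src_ne_tgt s (by rw [hsy, h1])).elim
    · simp only [List.concat_eq_append, List.append_assoc] at hw
      rw [← List.append_assoc, walk_concat, walk_concat] at hw
      exact (hs (by rw [hsy, ← hw.1.2]; exact hS c (by simp))).elim
  · exact h

/-- A step before `α₃` can destroy the invariant only by losing the vertex `tgt s`, and then `s y`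
is an isolated relation. Hence `y` composes without a relation with any arrow starting at its
target. Uniqueness of such predecessors makes `y` an arrow of `x`, respectively of `u α₂`, so that
its source `tgt s` lies in the set after all; in the boundary case `tgt s = src α₁`, and a cycle
appears. -/
theorem LeftInv.step {u x : List X} (h12 : B.Rel α₁ α₂) (h23 : B.Rel α₂ α₃)
    (hu : B.NZ (u ++ [α₂])) (wu : B.Walk (B.src α₁) u (B.tgt α₁)) (hu0 : u ≠ [])
    (hx : B.NZ (x ++ [α₃])) (wx : B.Walk (B.src α₂) x (B.tgt α₂)) (hx0 : x ≠ [])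
    (hxh : ¬ ∃ t, x = α₂ :: t)
    (hux : ∀ x', B.Walk (B.src α₂) x' (B.tgt α₂) →
      ¬ ∀ a ∈ u ++ x', B.tgt a = B.tgt α₂ ∨ ∃ b ∈ x, B.tgt a = B.src b)
    {w w' : List X} (hw : B.LeftInv α₁ α₂ α₃ u x w) (hs : B.Step w w') :
    B.LeftInv α₁ α₂ α₃ u x w' := by
  obtain ⟨r, rfl, wr, hD, hDu⟩ := hw
  obtain ⟨p, s, y, z, r₁, h1, rfl, hp, hr, hz⟩ := hs
  rcases List.eq_nil_or_concat r₁ with rfl | ⟨r₀, a, rfl⟩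
  · -- the relation at the end of the word
    have h2 : r = p ++ [s] ∧ α₃ = y := by
      have : r ++ [α₃] = (p ++ [s]) ++ [y] := by simpa using h1
      have := List.append_inj' this rfl
      simpa using this
    obtain ⟨rfl, rfl⟩ := h2
    obtain rfl := B.rel_left hr h23
    rw [walk_concat] at wr
    have : p = u := NZ.eq_of_last hp hu wr.1 (B.rel_comp h12 ▸ wu)
    subst this
    -- Here `s` is `α₂` and the word is `u α₂ α₃`. All targets in `u α₂` belong to the second set,
    -- so the second half of the invariant forbids any prolongation of `α₂`.
    have hnv : ¬ ∃ v, B.Non s v := by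
      intro hv
      refine hDu hv fun a ha => ?_
      rcases List.mem_append.1 ha with ha | ha
      · exact .inr ⟨a, ha, rfl⟩
      · left; rw [List.mem_singleton.1 ha]
    obtain ⟨hz0, hzn, hzw, ⟨t, rfl⟩ | ⟨t, rfl⟩ | hiso⟩ := hz
    · rcases t with _ | ⟨c, t⟩
      · have : B.tgt s = B.tgt α₃ := hzw.2
        exact (src_ne_tgt α₃ (by rw [← B.rel_comp hr, this])).elim
      · exact (hnv ⟨c, (nz_cons_cons.1 hzn).1⟩).elim
    · rw [walk_concat] at hzw
      refine ⟨p ++ t, by simp, walk_append.2 ⟨_, wr.1, ?_⟩, hux t ?_, fun hv => (hnv hv).elim⟩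
      · rw [B.rel_comp hr]; exact hzw.1
      · rw [B.rel_comp hr]; exact hzw.1
    · exact (hiso.2 _ h12).elim
  · -- a relation before `α₃`
    have h2 : r = p ++ s :: y :: r₀ ∧ α₃ = a := by
      have : r ++ [α₃] = (p ++ s :: y :: r₀) ++ [a] := by simpa using h1
      have := List.append_inj' this rfl
      simpa using this
    obtain ⟨rfl, rfl⟩ := h2
    obtain ⟨c, wp, wc⟩ := walk_append.1 wr
    obtain ⟨rfl, hsy, wr₀⟩ := wc
    have hcs : B.Conn (B.src α₁) (B.src s) := wp.conn
    have hst : B.src α₁ ≠ B.tgt s := fun h =>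
      B.not_conn s (by rw [← h]; exact hcs)
    -- The replacement `z` ends at `tgt y`, so `tgt s` is the only target that can be lost. This is
    -- applied to both sets of the invariant.
    have key : ∀ S : V → Prop, (∀ a ∈ p ++ (z ++ r₀), S (B.tgt a)) →
        (¬ ∀ a ∈ p ++ s :: y :: r₀, S (B.tgt a)) →
        ¬ S (B.tgt s) ∧ S (B.tgt y) ∧ (∀ d, ¬ B.Rel y d) := by
      intro S h h'
      have hy : S (B.tgt y) := by
        rcases List.eq_nil_or_concat z with rfl | ⟨z₀, c, rfl⟩
        · exact (hz.1 rfl).elim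
        · have hzw := hz.2.2.1
          simp only [List.concat_eq_append] at hzw h
          rw [walk_concat] at hzw
          rw [← hzw.2]; exact h c (by simp)
      have hs' : ¬ S (B.tgt s) := by
        intro hs'
        refine h' fun a ha => ?_
        simp only [List.mem_append, List.mem_cons] at ha
        rcases ha with ha | rfl | rfl | ha
        · exact h a (by simp [ha])
        · exact hs'
        · exact hy
        · exact h a (by simp [ha])
      exact ⟨hs', hy, (hz.avoid hs' hsy.symm fun a ha => h a (by simp [ha])).1⟩
    refine ⟨p ++ (z ++ r₀), by simp, ?_, ?_, ?_⟩
    · exact walk_append.2 ⟨_, wp, walk_append.2 ⟨_, hz.2.2.1, wr₀⟩⟩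
    · intro h
      obtain ⟨hs', hy, hiso⟩ := key (fun v => v = B.tgt α₂ ∨ ∃ b ∈ x, v = B.src b) h hD
      push Not at hs'
      rcases hy with hy | ⟨b, hb, hy⟩
      · have hn := non_of_not_rel (hy.trans (B.rel_comp h23)) (hiso α₃)
        rcases List.eq_nil_or_concat x with rfl | ⟨x₀, c, rfl⟩
        · exact hx0 rfl
        · have h3 : B.NZ (x₀ ++ c :: α₃ :: []) := by simpa using hx
          obtain rfl := B.non_left hn (nz_split.1 h3).2.1
          exact hs'.2 y (by simp) hsy.symm
      · have hn := non_of_not_rel hy (hiso b)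
        obtain ⟨x₁, x₂, rfl⟩ := List.append_of_mem hb
        rcases List.eq_nil_or_concat x₁ with rfl | ⟨x₀, c, rfl⟩
        -- When `b` is the first arrow of `x`, its predecessor without relation is `α₁`; then `tgt s
        -- = src α₁`, while the word already leads from `src α₁` to `src s`.
        · have hb2 : B.src b = B.src α₂ := wx.1
          have hn1 : B.Non α₁ b := by
            refine non_of_not_rel ((B.rel_comp h12).trans hb2.symm) fun hr1 => hxh ?_
            obtain rfl := B.rel_right hr1 h12
            exact ⟨x₂, rfl⟩
          obtain rfl := B.non_left hn hn1
          exact hst hsy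
        · have h3 : B.NZ (x₀ ++ c :: b :: (x₂ ++ [α₃])) := by simpa using hx
          obtain rfl := B.non_left hn (nz_split.1 h3).2.1
          exact hs'.2 y (by simp) hsy.symm
    · rintro ⟨v, hv⟩ h
      obtain ⟨hs', hy, hiso⟩ := key (fun v => v = B.tgt α₂ ∨ ∃ b ∈ u, v = B.tgt b) h (hDu ⟨v, hv⟩)
      push Not at hs'
      rcases hy with hy | ⟨b, hb, hy⟩
      · have hn := non_of_not_rel (hy.trans (B.non_comp hv)) (hiso v)
        obtain rfl := B.non_left hn hv
        rcases List.eq_nil_or_concat u with rfl | ⟨u₀, c, rfl⟩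
        · exact hu0 rfl
        · rw [List.concat_eq_append, walk_concat] at wu
          exact hs'.2 c (by simp) (by rw [wu.2, B.rel_comp h12, hsy])
      · obtain ⟨u₁, u₂, rfl⟩ := List.append_of_mem hb
        have hyb : y = b := by
          have h3 : ∃ d L, u₂ ++ [α₂] = d :: L := by
            cases u₂ with
            | nil => exact ⟨_, _, rfl⟩
            | cons d L => exact ⟨_, _, rfl⟩
          obtain ⟨d, L, h3⟩ := h3
          have h4 : B.NZ (u₁ ++ b :: d :: L) := by rw [← h3]; simpa using hu
          have h5 := (nz_split.1 h4).2.1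
          exact B.non_left (non_of_not_rel (hy.trans (B.non_comp h5)) (hiso d)) h5
        subst hyb
        rcases List.eq_nil_or_concat u₁ with rfl | ⟨u₀, c, rfl⟩
        · exact hst (wu.1.symm.trans hsy)
        · simp only [List.concat_eq_append] at wu
          obtain ⟨e, h6, h7, -⟩ := walk_append.1 wu
          rw [walk_concat] at h6
          exact hs'.2 c (by simp) (by rw [h6.2, ← h7, hsy])

/-- A walk of length one parallel to `α` would be `α` itself. The interior vertex obtained here is
the witness for the invariants below. -/
theorem exists_cons_cons {u : List X} {α : X} {a : V} (wu : B.Walk a u (B.tgt α))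
    (ha : a = B.src α) (hu0 : u ≠ []) (hne : u ≠ [α]) : ∃ c d t, u = c :: d :: t := by
  rcases u with _ | ⟨c, _ | ⟨d, t⟩⟩
  · exact (hu0 rfl).elim
  · exact (hne (by rw [B.parallel (wu.1.trans ha) wu.2])).elim
  · exact ⟨c, d, t, rfl⟩

/-- No path without relations can be reached from `u α₂ α₃` by more than one replacement. -/
theorem left_not_reach (h12 : B.Rel α₁ α₂) (h23 : B.Rel α₂ α₃) {z w : List X}
    (hz : B.Perm α₁ α₂ z) {n : ℕ} (hn : 2 ≤ n) (h : B.Reach n (z ++ [α₃]) w) (hw : B.NZ w) :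
    False := by
  obtain ⟨hz0, hzn, hzw, -⟩ := hz
  rcases List.eq_nil_or_concat z with rfl | ⟨u, c, rfl⟩
  · exact hz0 rfl
  simp only [List.concat_eq_append] at *
  have hc := (walk_concat.1 hzw).2
  have wu := (walk_concat.1 hzw).1
  -- Unless `z` ends with `α₂`, the word `z α₃` contains no relation and nothing can be replaced. So
  -- `z = u α₂`.
  by_cases hcr : B.Non c α₃
  · refine NZ.not_reach (n := n) ?_ (by omega) h
    have : B.NZ (u ++ c :: α₃ :: []) := nz_split.2 ⟨hzn, hcr, nz_singleton _⟩
    simpa using this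
  obtain rfl := B.rel_left (rel_of_not_non (hc.trans (B.rel_comp h23)) hcr) h23
  have hu0 : u ≠ [] := by
    rintro rfl
    have h1 : B.src α₁ = B.src c := wu
    exact src_ne_tgt α₁ (by rw [h1, B.rel_comp h12])
  rw [← B.rel_comp h12] at wu
  have hu1 : u ≠ [α₁] := by
    rintro rfl
    exact B.rel_not_non h12 (nz_cons_cons.1 hzn).1
  obtain _ | _ | n := n
  · omega
  · omega
  obtain ⟨w₁, hs, h⟩ := h
  have hs' : B.Step (u ++ c :: α₃ :: []) w₁ := by simpa using hs
  obtain ⟨z₂, rfl, hz₂⟩ := hs'.eq_of_leftmost hzn h23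
  rw [List.append_nil] at h
  -- If `z₂` starts with `α₂`, the new word has no relation although replacements are still due. The
  -- isolated case is excluded by `α₁ α₂`, which leaves `z₂ = x α₃`.
  by_cases hxh' : ∃ t, z₂ = c :: t
  · obtain ⟨t, rfl⟩ := hxh'
    exact NZ.not_reach (nz_glue.2 ⟨hzn, hz₂.2.1⟩) (by omega) h
  obtain ⟨hz₂0, hz₂n, hz₂w, h1 | ⟨x, rfl⟩ | h1⟩ := hz₂
  · exact hxh' h1
  swap
  · exact h1.2 _ h12
  rw [walk_concat] at hz₂w
  have wx := hz₂w.1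
  rw [← B.rel_comp h23] at wx
  have hx0 : x ≠ [] := by
    rintro rfl
    exact src_ne_tgt c wx
  have hxh : ¬ ∃ t, x = c :: t := by
    rintro ⟨t, rfl⟩
    exact hxh' ⟨_, rfl⟩
  obtain ⟨u₁, u₂, u', rfl⟩ := exists_cons_cons wu rfl hu0 hu1
  obtain ⟨x₁, x₂, x', rfl⟩ := exists_cons_cons wx rfl hx0
    (by rintro rfl; exact hxh ⟨[], rfl⟩)
  -- the vertices of `x` come after those in the interior of `u`
  have hu₁ : ¬ B.Conn (B.src c) (B.tgt u₁) := by
    intro hc1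
    have := Walk.eq_nil_of_conn (a := B.tgt u₁) wu.2 (by rw [B.rel_comp h12]; exact hc1)
    simp at this
  have hx₁ : ¬ B.Conn (B.tgt c) (B.tgt x₁) := by
    intro hc1
    have := Walk.eq_nil_of_conn wx.2 hc1
    simp at this
  have hsx : ∀ b ∈ x₁ :: x₂ :: x', B.Conn (B.src c) (B.src b) := by
    intro b hb
    obtain ⟨L, M, hLM⟩ := List.append_of_mem hb
    rw [hLM] at wx
    obtain ⟨d, h2, h3, -⟩ := walk_append.1 wx
    rw [h3]; exact h2.conn
  have hux : ∀ x'', B.Walk (B.src c) x'' (B.tgt c) →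
      ¬ ∀ a ∈ (u₁ :: u₂ :: u') ++ x'', B.tgt a = B.tgt c ∨
        ∃ b ∈ x₁ :: x₂ :: x', B.tgt a = B.src b := by
    intro x'' _ hall
    rcases hall u₁ (by simp) with h2 | ⟨b, hb, h2⟩
    · exact hu₁ (h2 ▸ B.conn_arrow c)
    · exact hu₁ (h2 ▸ hsx b hb)
  -- For a final word `r α₃` without relations, `r` has the same last arrow as `x`. Since `α₁ x` is
  -- also free of relations and has the same source, `r = α₁ x`. All its vertices lie in the first
  -- set, against the invariant.
  have hinv : ∀ m w', B.LeftInv α₁ c α₃ (u₁ :: u₂ :: u') (x₁ :: x₂ :: x') w' →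
      ¬ B.Reach m w' w := by
    intro m
    induction m with
    | zero =>
      rintro w' hw' rfl
      obtain ⟨r, rfl, wr, hD, -⟩ := hw'
      rcases List.eq_nil_or_concat r with rfl | ⟨r, d, rfl⟩
      · exact hD (by simp)
      simp only [List.concat_eq_append] at *
      have hw1 : B.NZ (r ++ d :: α₃ :: []) := by simpa using hw
      rw [nz_split] at hw1
      rw [walk_concat] at wr
      have hxa : B.Non α₁ x₁ := by
        refine non_of_not_rel ((B.rel_comp h12).trans wx.1.symm) fun hr1 => hxh ?_
        obtain rfl := B.rel_right hr1 h12
        exact ⟨_, rfl⟩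
      obtain ⟨x₀, e, hxe⟩ : ∃ x₀ e, x₁ :: x₂ :: x' = x₀ ++ [e] := by
        rcases List.eq_nil_or_concat (x₁ :: x₂ :: x') with h2 | ⟨x₀, e, h2⟩
        · simp at h2
        · exact ⟨x₀, e, by simpa using h2⟩
      have hxn : B.NZ (x₀ ++ e :: α₃ :: []) := by
        have := hz₂n
        rw [hxe] at this; simpa using this
      rw [nz_split] at hxn
      obtain rfl := B.non_left hw1.2.1 hxn.2.1
      have hxw : B.Walk (B.src α₁) (α₁ :: x₀) (B.src d) := by
        rw [hxe, walk_concat] at wx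
        exact ⟨rfl, B.rel_comp h12 ▸ wx.1⟩
      have hαx : B.NZ ((α₁ :: x₀) ++ [d]) := by
        rw [List.cons_append, ← hxe, nz_cons_cons]
        refine ⟨hxa, ?_⟩
        rw [hxe]; exact hxn.1
      obtain rfl := NZ.eq_of_last hw1.1 hαx wr.1 hxw
      refine hD fun a ha => ?_
      rw [List.cons_append, ← hxe] at ha
      rcases List.mem_cons.1 ha with rfl | ha
      · exact .inr ⟨x₁, by simp, by rw [B.rel_comp h12]; exact wx.1.symm⟩
      · obtain ⟨L, M, hLM⟩ := List.append_of_mem ha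
        rw [hLM] at wx
        obtain ⟨f, -, h3, h4⟩ := walk_append.1 wx
        rcases M with _ | ⟨g, M⟩
        · exact .inl h4
        · exact .inr ⟨g, by rw [hLM]; simp, h4.1.symm⟩
    | succ m ih =>
      rintro w' hw' ⟨w₂, hs2, h2⟩
      exact ih w₂ (hw'.step h12 h23 hzn wu hu0 hz₂n wx hx0 hxh hux hs2) h2
  -- The word `u x α₃` satisfies the invariant: the target of the first arrow of `u` comes strictly
  -- before `src α₂`, and that of the first arrow of `x` lies strictly between the ends of `α₂`.
  refine hinv (n + 1) _ ⟨(u₁ :: u₂ :: u') ++ (x₁ :: x₂ :: x'), by simp,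
    walk_append.2 ⟨_, wu, by rw [B.rel_comp h12]; exact wx⟩, hux _ wx, fun _ hall => ?_⟩ h
  rcases hall x₁ (by simp) with h2 | ⟨b, hb, h2⟩
  · exact hx₁ (h2 ▸ B.conn_refl _)
  · obtain ⟨L, M, hLM⟩ := List.append_of_mem hb
    rw [hLM] at wu
    obtain ⟨f, -, -, h4⟩ := walk_append.1 wu
    have h5 : B.Conn (B.tgt x₁) (B.src x₁) := by
      rw [h2, wx.1, ← B.rel_comp h12]; exact h4.conn
    exact B.not_conn x₁ h5

/-- The words which are dealt with in `right_not_reach`: those of the form `α₁ γ₁ R M`, where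
`α₁ γ₁ R` ends at the vertex `e`. -/
def RightInv (α₁ γ₁ : X) (e : V) (M w : List X) : Prop :=
  ∃ R, w = α₁ :: γ₁ :: R ++ M ∧ B.Walk (B.tgt γ₁) R e

/-- No path without relations can be reached from `α₁ α₂ α₃` by more than one replacement, the first
one of which is at the second relation. -/
theorem right_not_reach (h12 : B.Rel α₁ α₂) (h23 : B.Rel α₂ α₃) {z w : List X}
    (hz : B.Perm α₂ α₃ z) {n : ℕ} (hn : 2 ≤ n) (h : B.Reach n (α₁ :: z) w) (hw : B.NZ w) :
    False := by
  obtain ⟨hz0, hzn, hzw, -⟩ := hz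
  rcases z with _ | ⟨c, v⟩
  · exact hz0 rfl
  -- As on the left, a relation must survive, which forces `z = α₂ v`.
  by_cases hcr : B.Non α₁ c
  · exact NZ.not_reach (n := n) (nz_cons_cons.2 ⟨hcr, hzn⟩) (by omega) h
  obtain rfl := B.rel_right (rel_of_not_non ((B.rel_comp h12).trans hzw.1.symm) hcr) h12
  have wv := hzw.2
  have hv0 : v ≠ [] := by
    rintro rfl
    have h1 : B.tgt c = B.tgt α₃ := wv
    exact src_ne_tgt α₃ (by rw [← h1, B.rel_comp h23])
  have hv1 : v ≠ [α₃] := by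
    rintro rfl
    exact B.rel_not_non h23 (nz_cons_cons.1 hzn).1
  obtain ⟨v₁, v₂, v', rfl⟩ := exists_cons_cons wv (B.rel_comp h23) hv0 hv1
  obtain _ | _ | n := n
  · omega
  · omega
  obtain ⟨w₁, hs, h⟩ := h
  obtain ⟨z₂, rfl, hz₂⟩ := Step.eq_of_leftmost (p := []) hs (by simp) h12
  rw [List.nil_append] at h
  obtain ⟨hz₂0, hz₂n, hz₂w, hz₂c⟩ := hz₂
  -- Ending with `α₂` would remove all relations, and `α₂ α₃` rules out the isolated case. Hence `z₂
  -- = α₁ x` with `x` parallel to `α₂`.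
  by_cases hxl : ∃ t, z₂ = t ++ [c]
  · obtain ⟨t, rfl⟩ := hxl
    refine NZ.not_reach (n := n + 1) ?_ (by omega) h
    rw [List.append_assoc]
    exact nz_glue.2 ⟨hz₂n, hzn⟩
  rcases hz₂c with ⟨x, rfl⟩ | h1 | h1
  rotate_left
  · exact hxl h1
  · exact h1.1 _ h23
  have wx := hz₂w.2
  rw [B.rel_comp h12] at wx
  have hx0 : x ≠ [] := by
    rintro rfl
    exact src_ne_tgt c wx
  obtain ⟨γ₁, γ₂, x', rfl⟩ := exists_cons_cons wx rfl hx0 (by rintro rfl; exact hxl ⟨[α₁], rfl⟩)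
  obtain ⟨x₀, e, hxe⟩ : ∃ x₀ e, γ₂ :: x' = x₀ ++ [e] := by
    rcases List.eq_nil_or_concat (γ₂ :: x') with h2 | ⟨x₀, e, h2⟩
    · simp at h2
    · exact ⟨x₀, e, by simpa using h2⟩
  have wx₀ := wx.2
  rw [hxe, walk_concat] at wx₀
  have hnα := (nz_cons_cons.1 hz₂n).1
  have hnγ := (nz_cons_cons.1 (nz_cons_cons.1 hz₂n).2).1
  have hcγ : c ≠ γ₁ := fun h2 => B.rel_not_non h12 (h2 ▸ hnα)
  have hnv := (nz_cons_cons.1 hzn).1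
  have hnv2 := (nz_cons_cons.1 (nz_cons_cons.1 hzn).2).1
  have hec : e ≠ c := by
    rintro rfl
    exact hxl ⟨α₁ :: γ₁ :: x₀, by rw [hxe]; simp⟩
  have he3 : B.Non e α₃ := by
    refine non_of_not_rel (wx₀.2.trans (B.rel_comp h23)) fun h2 => hec ?_
    exact B.rel_left h2 h23
  have hv41 : ¬ B.Conn (B.tgt v₁) (B.tgt c) := by
    rw [B.non_comp hnv]; exact B.not_conn v₁
  have h47 : ¬ B.Conn (B.tgt α₃) (B.tgt v₁) := by
    intro h2
    have := Walk.eq_nil_of_conn wv.2 h2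
    simp at this
  have h23' : ¬ B.Conn (B.tgt c) (B.tgt γ₁) := by
    intro h2
    have := Walk.eq_nil_of_conn wx.2 h2
    simp at this
  -- a path of this form contains a relation
  have hT : ∀ R, B.Walk (B.tgt γ₁) R (B.tgt v₁) → ¬ B.NZ (α₁ :: γ₁ :: R) := by
    intro R wR hR
    -- Comparison with `α₁ x`, which ends at `tgt α₂`. If `R` stops no later, `tgt v₁` leads back to
    -- `tgt α₂`, the source of `v₁`. If it goes further, the next arrow is `α₃`, and from `tgt α₃`
    -- the vertex `tgt v₁` is out of reach.
    rcases NZ.prefix_or hR hz₂n with ⟨T, hT⟩ | ⟨T, hT⟩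
    · simp only [List.cons_append, List.cons.injEq, true_and] at hT
      have hw2 := wx.2
      rw [hT] at hw2
      obtain ⟨d, h2, h3⟩ := walk_append.1 hw2
      obtain rfl := h2.unique wR
      exact hv41 h3.conn
    · simp only [List.cons_append, List.cons.injEq, true_and] at hT
      rw [hT, ← List.cons_append, walk_append] at wR
      obtain ⟨d, h2, h3⟩ := wR
      obtain rfl := h2.unique wx.2
      rcases T with _ | ⟨δ, T⟩
      · have h4 : B.tgt c = B.tgt v₁ := h3
        exact hv41 (h4 ▸ B.conn_refl _)
      · have h4 : B.NZ ((α₁ :: γ₁ :: x₀) ++ e :: δ :: T) := by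
          rw [hT, ← List.cons_append, hxe] at hR
          simpa using hR
        obtain rfl := B.non_right (nz_split.1 h4).2.1 he3
        exact h47 h3.2.conn
  -- the first two arrows of the word do not change
  have hstep : ∀ w w', B.RightInv α₁ γ₁ (B.tgt v₁) (v₂ :: v') w → B.Step w w' →
      B.RightInv α₁ γ₁ (B.tgt v₁) (v₂ :: v') w' := by
    rintro _ _ ⟨R, rfl, wR⟩ ⟨p, s, y, t, r₁, h1, rfl, hp, hr, ht⟩
    -- By `hT` the part `α₁ γ₁ R` contains a relation, so the leftmost one lies there and the suffix
    -- is untouched.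
    obtain ⟨r, h2, rfl⟩ : ∃ r, α₁ :: γ₁ :: R = p ++ s :: y :: r ∧ r₁ = r ++ v₂ :: v' := by
      have h3 : (α₁ :: γ₁ :: R) ++ v₂ :: v' = (p ++ [s, y]) ++ r₁ := by simpa using h1
      rcases List.append_eq_append_iff.1 h3 with ⟨a, h4, h5⟩ | ⟨a, h4, h5⟩
      · rcases List.eq_nil_or_concat a with rfl | ⟨a, b, rfl⟩
        · exact ⟨[], by simpa using h4.symm, by simpa using h5.symm⟩
        · exfalso
          have h6 : p ++ [s] = (α₁ :: γ₁ :: R) ++ a := by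
            have h7 : (p ++ [s]) ++ [y] = ((α₁ :: γ₁ :: R) ++ a) ++ [b] := by simpa using h4
            exact (List.append_inj' h7 rfl).1
          rw [h6] at hp
          exact hT R wR hp.left
      · exact ⟨a, by simpa using h4, h5⟩
    rcases p with _ | ⟨p₁, _ | ⟨p₂, p⟩⟩
    · simp only [List.nil_append, List.cons.injEq] at h2
      obtain ⟨rfl, rfl, -⟩ := h2
      exact (B.rel_not_non hr hnα).elim
    · simp only [List.cons_append, List.nil_append, List.cons.injEq] at h2
      obtain ⟨rfl, rfl, rfl⟩ := h2
      obtain ⟨ht0, htn, htw, htc⟩ := ht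
      rcases t with _ | ⟨d, t⟩
      · exact (ht0 rfl).elim
      -- The only step that could change `γ₁` replaces `γ₁ y` by a path starting with `α₂`. If that
      -- path is `α₂` alone, then `y` is `α₂` or the last arrow of `x`; otherwise it must be `α₂
      -- v₁`, and `y = v₁`. Each case contradicts acyclicity, or the fact that `γ₁ γ₂` is not a
      -- relation.
      by_cases hd : B.Non α₁ d
      · obtain rfl := B.non_right hd hnα
        exact ⟨t ++ r, by simp, walk_append.2 ⟨_, htw.2, wR.2⟩⟩
      exfalso
      obtain rfl := B.rel_right
        (rel_of_not_non ((B.non_comp hnα).trans htw.1.symm) hd) h12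
      have hy7 : B.Conn (B.tgt y) (B.tgt v₁) := wR.2.conn
      rcases t with _ | ⟨b, t⟩
      · -- the replacement is `α₂`
        have h3 : B.tgt d = B.tgt y := htw.2
        by_cases h4 : B.Rel y α₃
        · obtain rfl := B.rel_left h4 h23
          exact B.not_conn γ₁ (by rw [wR.1.symm, ← htw.1]; exact B.conn_refl _)
        · obtain rfl := B.non_left (non_of_not_rel (h3.symm.trans (B.rel_comp h23)) h4) he3
          rcases x₀ with _ | ⟨f, x₀⟩
          · simp only [List.nil_append, List.cons.injEq] at hxe
            obtain ⟨rfl, -⟩ := hxe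
            exact B.rel_not_non hr hnγ
          · have h5 := wx₀.1
            rw [wR.1] at h5
            simpa using h5.eq_nil
      · obtain rfl := B.non_right (nz_cons_cons.1 htn).1 hnv
        have h4 := htw.2.2.eq_nil_of_conn hy7
        subst h4
        have h7 : B.tgt b = B.tgt y := htw.2.2
        rcases htc with ⟨t, h5⟩ | ⟨t, h5⟩ | h5
        · exact hcγ (List.cons.inj h5).1
        · have h6 : y = b := by
            have : [d] ++ [b] = t ++ [y] := h5
            have := List.append_inj' this rfl
            simpa using this.2.symm
          subst h6
          exact h23' (by rw [B.non_comp hnv, wR.1]; exact B.conn_refl _)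
        · have h6 := non_of_not_rel (h7.symm.trans (B.non_comp hnv2)) (h5.1 v₂)
          obtain rfl := B.non_left h6 hnv2
          exact h23' (by rw [B.non_comp hnv, wR.1]; exact B.conn_refl _)
    · simp only [List.cons_append, List.cons.injEq] at h2
      obtain ⟨rfl, rfl, rfl⟩ := h2
      obtain ⟨f, h3, h4⟩ := walk_append.1 wR
      obtain ⟨rfl, -, h5⟩ := h4
      exact ⟨p ++ (t ++ r), by simp,
        walk_append.2 ⟨_, h3, walk_append.2 ⟨_, ht.2.2.1, h5⟩⟩⟩
  have hinv : ∀ m w', B.RightInv α₁ γ₁ (B.tgt v₁) (v₂ :: v') w' → ¬ B.Reach m w' w := by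
    intro m
    induction m with
    | zero =>
      rintro w' ⟨R, rfl, wR⟩ rfl
      exact hT R wR hw.left
    | succ m ih =>
      rintro w' hw' ⟨w₂, hs2, h2⟩
      exact ih w₂ (hstep _ _ hw' hs2) h2
  refine hinv (n + 1) _ ⟨γ₂ :: x' ++ [v₁], by simp, walk_append.2 ⟨_, wx.2, ?_⟩⟩ h
  exact ⟨(B.non_comp hnv).symm, rfl⟩

end BoundQuiver

/-! ### The list of arrows of a path -/

section Arrows

variable {V : Type*} [Quiver V]

/-- The arrows of a path, from left to right. -/
def arr {a : V} : ∀ {b : V}, Path a b → List (Arrow V)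
  | _, Path.nil => []
  | _, Path.cons p e => arr p ++ [⟨_, _, e⟩]

@[simp] theorem arr_nil (a : V) : arr (Path.nil : Path a a) = [] := rfl

@[simp] theorem arr_cons {a b c : V} (p : Path a b) (e : b ⟶ c) :
    arr (p.cons e) = arr p ++ [⟨_, _, e⟩] := rfl

@[simp] theorem arr_comp {a b c : V} (p : Path a b) (q : Path b c) :
    arr (p.comp q) = arr p ++ arr q := by
  induction q with
  | nil => simp
  | cons q e ih => simp [ih]

theorem arr_toPath {a b : V} (e : a ⟶ b) : arr e.toPath = [⟨a, b, e⟩] := rfl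

theorem arr_toQPath (d : Arrow V) : arr d.toQPath.2.2 = [d] := rfl

/-- The source is fixed because an empty list of arrows does not determine a vertex; the target has
to be recovered along with the path. -/
theorem arr_inj {a b b' : V} (p : Path a b) (q : Path a b') (h : arr p = arr q) :
    (⟨b, p⟩ : Σ b, Path a b) = ⟨b', q⟩ := by
  induction p generalizing b' with
  | nil =>
    cases q with
    | nil => rfl
    | cons q e => simp at h
  | cons p e ih =>
    cases q with
    | nil => simp at h
    | cons q e' =>
      obtain ⟨h1, h2⟩ := List.append_inj' h rfl
      have h3 := ih q h1
      simp only [Sigma.mk.injEq] at h3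
      obtain ⟨rfl, h3⟩ := h3
      obtain rfl := eq_of_heq h3
      simp only [List.cons.injEq, Sigma.mk.injEq, heq_eq_eq, true_and, and_true] at h2
      obtain ⟨rfl, h2⟩ := h2
      obtain rfl := eq_of_heq h2
      rfl

theorem src_eq_of_arr {p : QPath V} {x : Arrow V} {L : List (Arrow V)} (h : arr p.2.2 = x :: L) :
    p.1 = x.src := by
  obtain ⟨a, b, p⟩ := p
  dsimp only at h ⊢
  induction p generalizing L with
  | nil => simp at h
  | cons p e ih =>
    rw [arr_cons] at h
    rcases hp : arr p with _ | ⟨y, M⟩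
    · cases p with
      | nil => simp at h; rw [← h.1]
      | cons p e' => simp at hp
    · rw [hp] at h
      simp only [List.cons_append, List.cons.injEq] at h
      obtain ⟨rfl, -⟩ := h
      exact ih hp

theorem tgt_eq_of_arr {p : QPath V} {x : Arrow V} {L : List (Arrow V)}
    (h : arr p.2.2 = L ++ [x]) : p.2.1 = x.tgt := by
  obtain ⟨a, b, p⟩ := p
  dsimp only at h ⊢
  cases p with
  | nil => simp at h
  | cons p e =>
    have := (List.append_inj' h rfl).2
    simp only [List.cons.injEq, and_true] at this
    rw [← this]

theorem QPath.ext_arr {p q : QPath V} (h : arr p.2.2 = arr q.2.2) (h0 : arr p.2.2 ≠ []) :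
    p = q := by
  rcases hp : arr p.2.2 with _ | ⟨x, L⟩
  · exact (h0 hp).elim
  have h1 := src_eq_of_arr hp
  have h2 := src_eq_of_arr (h ▸ hp)
  obtain ⟨a, b, p⟩ := p
  obtain ⟨a', b', q⟩ := q
  dsimp only at h1 h2
  obtain rfl : a = a' := h1.trans h2.symm
  have := arr_inj p q h
  rw [this]

theorem eq_trivial_of_arr {p : QPath V} (h : arr p.2.2 = []) : ∃ v, p = trivialPath v := by
  obtain ⟨a, b, p⟩ := p
  cases p with
  | nil => exact ⟨a, rfl⟩
  | cons p e => simp at h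

theorem exists_cons_of_arr {p : QPath V} {L : List (Arrow V)} {x : Arrow V}
    (h : arr p.2.2 = L ++ [x]) :
    ∃ (a b c : V) (p' : Path a b) (e : b ⟶ c), p = ⟨a, c, p'.cons e⟩ ∧ arr p' = L ∧
      x = ⟨b, c, e⟩ := by
  obtain ⟨a, b, p⟩ := p
  cases p with
  | nil => simp at h
  | cons p e =>
    obtain ⟨h1, h2⟩ := List.append_inj' h rfl
    simp only [List.cons.injEq, and_true] at h2
    exact ⟨_, _, _, p, e, rfl, h1, h2.symm⟩

theorem splits_trivial (v : V) : (trivialPath v).splits = [] := rfl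

theorem splits_getLast {a b c : V} (p : Path a b) (e : b ⟶ c) :
    (QPath.splits ⟨a, c, p.cons e⟩).getLast? = some (⟨a, b, p⟩, ⟨b, c, e⟩, trivialPath c) := by
  simp [QPath.splits, splitsAux, trivialPath]

theorem splitsAux_cons {a b : V} (p : Path a b) (hp : arr p ≠ []) :
    ∃ y T, splitsAux p = y :: T ∧ arr y.2.2.1 = [] ∧
      (arr p = ⟨y.1, y.2.1, y.2.2.2.1⟩ :: arr y.2.2.2.2) ∧
      ∀ z ∈ T, arr z.2.2.1 ≠ [] ∧
        arr p = arr z.2.2.1 ++ ⟨z.1, z.2.1, z.2.2.2.1⟩ :: arr z.2.2.2.2 := by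
  induction p with
  | nil => simp at hp
  | cons p e ih =>
    by_cases hp0 : arr p = []
    · cases p with
      | nil => exact ⟨_, [], rfl, rfl, rfl, by simp⟩
      | cons p e' => simp at hp0
    · obtain ⟨y, T, h1, h2, h3, h4⟩ := ih hp0
      refine ⟨_, T.map (fun x => ⟨x.1, x.2.1, x.2.2.1, x.2.2.2.1, x.2.2.2.2.cons e⟩) ++
        [⟨_, _, p, e, Path.nil⟩], by rw [splitsAux, h1]; rfl, h2, ?_, ?_⟩
      · simp [h3]
      · intro z hz
        simp only [List.mem_append, List.mem_map, List.mem_singleton] at hz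
        rcases hz with ⟨z', hz', rfl⟩ | rfl
        · obtain ⟨h5, h6⟩ := h4 z' hz'
          refine ⟨h5, ?_⟩
          rw [arr_cons, h6]; simp
        · exact ⟨hp0, by simp⟩

/-- The first factorization of a path starts with a trivial path, the other ones do not. -/
theorem splits_cons {p : QPath V} (hp : arr p.2.2 ≠ []) :
    ∃ y T, p.splits = y :: T ∧ arr p.2.2 = y.2.1 :: arr y.2.2.2.2 ∧ y.2.2.1 = y.2.1.tgt ∧
      ∀ z ∈ T, arr z.1.2.2 ≠ [] ∧ arr p.2.2 = arr z.1.2.2 ++ z.2.1 :: arr z.2.2.2.2 := by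
  obtain ⟨y, T, h1, h2, h3, h4⟩ := splitsAux_cons p.2.2 hp
  refine ⟨_, _, by rw [QPath.splits, h1]; rfl, h3, rfl, ?_⟩
  intro z hz
  obtain ⟨z', hz', rfl⟩ := List.mem_map.1 hz
  exact h4 z' hz'

end Arrows

/-! ### The bound quiver of a gentle algebra -/

section Words

variable {k V : Type*} [Field k] [Quiver V] [Fintype V] {I : TwoSidedIdeal (PathAlgebra k V)}

/-- The bound quiver of a gentle algebra without oriented cycles and parallel arrows. -/
def IsGentle.boundQuiver (hI : IsGentle I) (hcyc : NoOrientedCycles V) (hpar : NoParallelArrows V) :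
    BoundQuiver (Arrow V) V where
  src := Arrow.src
  tgt := Arrow.tgt
  Rel := IsRel I
  Non := IsNonRel I
  Conn a b := Nonempty (Path a b)
  conn_refl v := ⟨Path.nil⟩
  conn_trans := fun ⟨p⟩ ⟨q⟩ => ⟨p.comp q⟩
  conn_arrow a := ⟨a.2.2.toPath⟩
  not_conn := fun a ⟨p⟩ => by simpa using hcyc _ (p.cons a.2.2)
  rel_comp h := h.1
  non_comp h := h.1
  rel_or_non {a b} h := (Classical.em (arrowMul k a b ∈ I)).imp (fun h' => ⟨h, h'⟩) fun h' => ⟨h, h'⟩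
  rel_not_non h h' := h'.2 h.2
  rel_right h h' := hI.rel_right _ _ _ h h'
  rel_left h h' := hI.rel_left _ _ _ h h'
  non_right h h' := hI.nonrel_right _ _ _ h h'
  non_left h h' := hI.nonrel_left _ _ _ h h'
  parallel := by
    rintro ⟨a, b, e⟩ ⟨a', b', e'⟩ h h'
    change a = a' at h
    change b = b' at h'
    subst h h'
    have := hpar a b
    rw [Subsingleton.elim e e']

/-- The product of the classes of the arrows of a list. -/
def ev (I : TwoSidedIdeal (PathAlgebra k V)) (L : List (Arrow V)) : QuotAlg I :=
  (L.map fun α => cls I α.toQPath).prod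

@[simp] theorem ev_nil : ev I [] = 1 := rfl

@[simp] theorem ev_cons (α : Arrow V) (L : List (Arrow V)) :
    ev I (α :: L) = cls I α.toQPath * ev I L := by simp [ev]

theorem ev_append (L M : List (Arrow V)) : ev I (L ++ M) = ev I L * ev I M := by simp [ev]

theorem cls_mul_cls {a b c : V} (p : Path a b) (q : Path b c) :
    cls I ⟨a, b, p⟩ * cls I ⟨b, c, q⟩ = cls I ⟨a, c, p.comp q⟩ := by
  rw [cls, cls, cls, ← map_mul, ofPath_mul_comp]

theorem cls_mul_ne (p q : QPath V) (h : p.2.1 ≠ q.1) : cls I p * cls I q = 0 := by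
  rw [cls, cls, ← map_mul, ofPath_mul_ne _ _ h, map_zero]

theorem trivial_mul_cls (p : QPath V) : cls I (trivialPath p.1) * cls I p = cls I p := by
  obtain ⟨a, b, p⟩ := p
  rw [trivialPath, cls_mul_cls, Path.nil_comp]

theorem cls_mul_trivial (p : QPath V) : cls I p * cls I (trivialPath p.2.1) = cls I p := by
  obtain ⟨a, b, p⟩ := p
  rw [trivialPath, cls_mul_cls, Path.comp_nil]

/-- The idempotent cannot be omitted: `ev I []` is the unit of the algebra, not the class of one
trivial path. For paths of positive length it is absorbed by the first arrow. -/
theorem cls_eq_trivial_mul_ev (p : QPath V) :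
    cls I p = cls I (trivialPath p.1) * ev I (arr p.2.2) := by
  obtain ⟨a, b, p⟩ := p
  dsimp only
  induction p with
  | nil => simp [trivialPath]
  | cons p e ih =>
    rw [arr_cons, ev_append, ← mul_assoc, ← ih, ev_cons, ev_nil, mul_one, Arrow.toQPath,
      cls_mul_cls]
    rfl

theorem cls_eq_ev {p : QPath V} (hp : arr p.2.2 ≠ []) : cls I p = ev I (arr p.2.2) := by
  rw [cls_eq_trivial_mul_ev]
  rcases h : arr p.2.2 with _ | ⟨x, L⟩
  · exact (hp h).elim
  rw [src_eq_of_arr h, ev_cons, ← mul_assoc]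
  congr 1
  exact trivial_mul_cls x.toQPath

theorem cls_eq_ev_mul_trivial (p : QPath V) :
    cls I p = ev I (arr p.2.2) * cls I (trivialPath p.2.1) := by
  by_cases hp : arr p.2.2 = []
  · obtain ⟨v, rfl⟩ := eq_trivial_of_arr hp
    simp [trivialPath]
  · rw [← cls_eq_ev hp, cls_mul_trivial]

variable (hI : IsGentle I) (hcyc : NoOrientedCycles V) (hpar : NoParallelArrows V)

theorem nz_of_ev_ne_zero {L : List (Arrow V)} (h : ev I L ≠ 0) :
    (hI.boundQuiver hcyc hpar).NZ L := by
  induction L with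
  | nil => simp
  | cons a L ih =>
    have hL : ev I L ≠ 0 := by
      intro h0; exact h (by rw [ev_cons, h0, mul_zero])
    rcases L with _ | ⟨b, L⟩
    · simp
    refine BoundQuiver.nz_cons_cons.2 ⟨?_, ih hL⟩
    have h1 : cls I a.toQPath * cls I b.toQPath ≠ 0 := by
      intro h0; exact h (by rw [ev_cons, ev_cons, ← mul_assoc, h0, zero_mul])
    have h2 : a.tgt = b.src := by
      by_contra h2; exact h1 (cls_mul_ne _ _ h2)
    refine ⟨h2, fun h3 => h1 ?_⟩
    rw [cls, cls, ← map_mul, proj_eq_zero_iff]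
    exact h3

theorem ev_eq_zero {L : List (Arrow V)} (h : ¬ (hI.boundQuiver hcyc hpar).NZ L) : ev I L = 0 := by
  by_contra h'
  exact h (nz_of_ev_ne_zero hI hcyc hpar h')

/-- The combinations of paths containing a relation form an ideal. -/
theorem not_nz_of_mem {x : PathAlgebra k V} (hx : x ∈ I) (p : QPath V)
    (hp : (PathAlgebra.basis k V).repr x p ≠ 0) :
    ¬ (hI.boundQuiver hcyc hpar).NZ (arr p.2.2) := by
  set B := hI.boundQuiver hcyc hpar
  let S : Submodule k (PathAlgebra k V) := Submodule.span k
    {y | ∃ p : QPath V, ¬ B.NZ (arr p.2.2) ∧ y = PathAlgebra.ofPath k p}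
  have hl : ∀ {x y : PathAlgebra k V}, y ∈ S → x * y ∈ S := by
    intro x y hy
    induction hy using Submodule.span_induction with
    | zero => rw [mul_zero]; exact Submodule.zero_mem _
    | add y₁ y₂ _ _ h₁ h₂ => rw [mul_add]; exact Submodule.add_mem _ h₁ h₂
    | smul c y _ h => rw [mul_smul_comm]; exact Submodule.smul_mem _ _ h
    | mem y hy =>
      obtain ⟨q, hq, rfl⟩ := hy
      induction x using pathAlgebra_induction with
      | h0 => rw [zero_mul]; exact Submodule.zero_mem _
      | hadd x₁ x₂ h₁ h₂ => rw [add_mul]; exact Submodule.add_mem _ h₁ h₂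
      | hsm c p =>
        rw [smul_mul_assoc]
        refine Submodule.smul_mem _ _ ?_
        obtain ⟨a, b, p⟩ := p
        obtain ⟨b', d, q⟩ := q
        by_cases h : b = b'
        · subst h
          refine Submodule.subset_span ⟨_, ?_, ofPath_mul_comp p q⟩
          rw [arr_comp]
          exact fun h' => hq h'.right
        · rw [ofPath_mul_ne _ _ h]; exact Submodule.zero_mem _
  have hr : ∀ {y x : PathAlgebra k V}, y ∈ S → y * x ∈ S := by
    intro y x hy
    induction hy using Submodule.span_induction with
    | zero => rw [zero_mul]; exact Submodule.zero_mem _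
    | add y₁ y₂ _ _ h₁ h₂ => rw [add_mul]; exact Submodule.add_mem _ h₁ h₂
    | smul c y _ h => rw [smul_mul_assoc]; exact Submodule.smul_mem _ _ h
    | mem y hy =>
      obtain ⟨q, hq, rfl⟩ := hy
      induction x using pathAlgebra_induction with
      | h0 => rw [mul_zero]; exact Submodule.zero_mem _
      | hadd x₁ x₂ h₁ h₂ => rw [mul_add]; exact Submodule.add_mem _ h₁ h₂
      | hsm c p =>
        rw [mul_smul_comm]
        refine Submodule.smul_mem _ _ ?_
        obtain ⟨a, b, p⟩ := p
        obtain ⟨b', d, q⟩ := q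
        by_cases h : d = a
        · subst h
          refine Submodule.subset_span ⟨_, ?_, ofPath_mul_comp q p⟩
          rw [arr_comp]
          exact fun h' => hq h'.left
        · rw [ofPath_mul_ne _ _ h]; exact Submodule.zero_mem _
  have hneg : ∀ {x : PathAlgebra k V}, x ∈ S → -x ∈ S := by
    intro x hx
    have h2 : -x = (-1 : PathAlgebra k V) * x := by rw [neg_one_mul]
    rw [h2]; exact hl hx
  -- `S` is a two-sided ideal and contains the length-two generators of `I`.
  have hx' : x ∈ S := by
    have h1 : x ∈ TwoSidedIdeal.mk' (S : Set (PathAlgebra k V)) S.zero_mem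
        (fun hx hy => S.add_mem hx hy) hneg hl hr := by
      have hx1 := hx
      rw [hI.generated, TwoSidedIdeal.mem_span_iff] at hx1
      refine hx1 _ ?_
      rintro y ⟨⟨a, b, α⟩, ⟨b', c, β⟩, ⟨hc, hm⟩, rfl⟩
      obtain rfl : b = b' := hc
      rw [SetLike.mem_coe, TwoSidedIdeal.mem_mk']
      refine Submodule.subset_span ⟨_, ?_, ofPath_arrow_mul k α β⟩
      rw [arr_comp, arr_toPath, arr_toPath, List.singleton_append, BoundQuiver.nz_cons_cons]
      exact fun h => h.1.2 hm
    rwa [TwoSidedIdeal.mem_mk', SetLike.mem_coe] at h1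
  intro hpn
  refine hp ?_
  clear hp hx
  induction hx' using Submodule.span_induction with
  | zero => simp
  | add y₁ y₂ _ _ h₁ h₂ => simp [h₁, h₂]
  | smul c y _ h => simp [h]
  | mem y hy =>
    obtain ⟨q, hq, rfl⟩ := hy
    rw [PathAlgebra.ofPath, Module.Basis.repr_self, Finsupp.single_apply, if_neg]
    rintro rfl
    exact hq hpn

/-- Only paths containing a relation occur in elements of `I`, whereas a path occurs in itself with
coefficient one. Together with `nz_arr` this identifies the path basis with the words free of
relations. -/
theorem cls_ne_zero {p : QPath V} (h : (hI.boundQuiver hcyc hpar).NZ (arr p.2.2)) :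
    cls I p ≠ 0 := by
  intro h0
  rw [cls, proj_eq_zero_iff] at h0
  refine not_nz_of_mem hI hcyc hpar h0 p ?_ h
  rw [PathAlgebra.ofPath, Module.Basis.repr_self, Finsupp.single_eq_same]
  exact one_ne_zero

theorem nz_arr {p : QPath V} (h : cls I p ≠ 0) : (hI.boundQuiver hcyc hpar).NZ (arr p.2.2) := by
  refine nz_of_ev_ne_zero hI hcyc hpar fun h0 => h ?_
  rw [cls_eq_trivial_mul_ev, h0, mul_zero]

theorem walk_arr (p : QPath V) {v w : V} (hv : p.1 = v) (hw : p.2.1 = w) :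
    (hI.boundQuiver hcyc hpar).Walk v (arr p.2.2) w := by
  subst hv hw
  obtain ⟨a, b, p⟩ := p
  dsimp only
  induction p with
  | nil => rfl
  | cons p e ih => rw [arr_cons, BoundQuiver.walk_concat]; exact ⟨ih, rfl⟩

theorem exists_path_of_nz {L : List (Arrow V)} (h : (hI.boundQuiver hcyc hpar).NZ L)
    (h0 : L ≠ []) : ∃ p : QPath V, arr p.2.2 = L := by
  induction L using List.reverseRecOn with
  | nil => exact (h0 rfl).elim
  | append_singleton L x ih =>
    rcases List.eq_nil_or_concat L with rfl | ⟨L, y, rfl⟩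
    · exact ⟨x.toQPath, rfl⟩
    · rw [List.concat_eq_append] at *
      obtain ⟨p, hp⟩ := ih h.left (by simp)
      have h1 : (hI.boundQuiver hcyc hpar).NZ (L ++ y :: x :: []) := by simpa using h
      have h2 : y.tgt = x.src := (BoundQuiver.nz_split.1 h1).2.1.1
      obtain ⟨a, b, p⟩ := p
      obtain ⟨c, d, e⟩ := x
      obtain rfl : b = c := (tgt_eq_of_arr hp).trans h2
      exact ⟨⟨a, d, p.cons e⟩, by simp only [arr_cons]; rw [hp]⟩

end Words

-- Coefficients in the path basis and the shape of the values of a cocycle.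

section Coordinates

variable {k V : Type*} [Field k] [Quiver V] [Fintype V] {I : TwoSidedIdeal (PathAlgebra k V)}

theorem cls_mul_cases (I : TwoSidedIdeal (PathAlgebra k V)) (q r : QPath V) :
    (q.2.1 ≠ r.1 ∧ cls I q * cls I r = 0) ∨
      ∃ s : QPath V, arr s.2.2 = arr q.2.2 ++ arr r.2.2 ∧ cls I q * cls I r = cls I s := by
  by_cases h : q.2.1 = r.1
  · obtain ⟨a, b, q⟩ := q
    obtain ⟨b', c, r⟩ := r
    obtain rfl : b = b' := h
    exact .inr ⟨_, arr_comp q r, cls_mul_cls q r⟩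
  · exact .inl ⟨h, cls_mul_ne _ _ h⟩

variable (hI : IsGentle I)

theorem pathBasis_apply (p : NonzeroPath I) : hI.pathBasis p = cls I p.1 :=
  Module.Basis.mk_apply _ _ _

theorem coord_cls (p : NonzeroPath I) (q : QPath V) :
    hI.pathBasis.coord p (cls I q) = if q = p.1 then 1 else 0 := by
  by_cases hq : cls I q = 0
  · rw [hq, map_zero, if_neg]
    rintro rfl
    exact p.2 hq
  · rw [← pathBasis_apply hI ⟨q, hq⟩, Module.Basis.coord_apply, Module.Basis.repr_self,
      Finsupp.single_apply]
    exact if_congr Subtype.ext_iff rfl rfl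

/-- Appending `d` is injective on paths, so `p` is the only basis path whose product with `d` can be
`q = p d`. -/
theorem coord_mul_arrow {p q : NonzeroPath I} {d : Arrow V} (hp : arr p.1.2.2 ≠ [])
    (hpd : p.1.2.1 = d.src) (hq : arr q.1.2.2 = arr p.1.2.2 ++ [d]) (x : QuotAlg I) :
    hI.pathBasis.coord q (x * cls I d.toQPath) = hI.pathBasis.coord p x := by
  have : hI.pathBasis.coord q ∘ₗ LinearMap.mulRight k (cls I d.toQPath) =
      hI.pathBasis.coord p := by
    refine hI.pathBasis.ext fun r => ?_
    rw [LinearMap.comp_apply, LinearMap.mulRight_apply, pathBasis_apply, coord_cls]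
    rcases cls_mul_cases I r.1 d.toQPath with ⟨h, h0⟩ | ⟨s, hs, h0⟩
    · rw [h0, map_zero, if_neg]
      intro hr
      exact h (by rw [hr]; exact hpd)
    · rw [h0, coord_cls]
      refine if_congr ⟨fun h => ?_, fun h => ?_⟩ rfl rfl
      · rw [h, hq, arr_toQPath] at hs
        exact (QPath.ext_arr (List.append_cancel_right hs) hp).symm
      · rw [h, arr_toQPath, ← hq] at hs
        exact QPath.ext_arr hs (by rw [hs, hq]; simp)
  exact LinearMap.congr_fun this x

theorem coord_arrow_mul {p q : NonzeroPath I} {d : Arrow V} (hp : arr p.1.2.2 ≠ [])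
    (hpd : d.tgt = p.1.1) (hq : arr q.1.2.2 = d :: arr p.1.2.2) (x : QuotAlg I) :
    hI.pathBasis.coord q (cls I d.toQPath * x) = hI.pathBasis.coord p x := by
  have : hI.pathBasis.coord q ∘ₗ LinearMap.mulLeft k (cls I d.toQPath) =
      hI.pathBasis.coord p := by
    refine hI.pathBasis.ext fun r => ?_
    rw [LinearMap.comp_apply, LinearMap.mulLeft_apply, pathBasis_apply, coord_cls]
    rcases cls_mul_cases I d.toQPath r.1 with ⟨h, h0⟩ | ⟨s, hs, h0⟩
    · rw [h0, map_zero, if_neg]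
      intro hr
      exact h (by rw [hr]; exact hpd)
    · rw [h0, coord_cls]
      refine if_congr ⟨fun h => ?_, fun h => ?_⟩ rfl rfl
      · rw [h, hq, arr_toQPath] at hs
        exact (QPath.ext_arr (List.cons.inj hs).2 hp).symm
      · rw [h, arr_toQPath, List.singleton_append, ← hq] at hs
        exact QPath.ext_arr hs (by rw [hs, hq]; simp)
  exact LinearMap.congr_fun this x

theorem coord_mul_arrow_eq_zero {q : NonzeroPath I} {d : Arrow V}
    (hq : ¬ ∃ t, arr q.1.2.2 = t ++ [d]) (x : QuotAlg I) :
    hI.pathBasis.coord q (x * cls I d.toQPath) = 0 := by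
  have : hI.pathBasis.coord q ∘ₗ LinearMap.mulRight k (cls I d.toQPath) = 0 := by
    refine hI.pathBasis.ext fun r => ?_
    rw [LinearMap.comp_apply, LinearMap.mulRight_apply, pathBasis_apply, LinearMap.zero_apply]
    rcases cls_mul_cases I r.1 d.toQPath with ⟨h, h0⟩ | ⟨s, hs, h0⟩
    · rw [h0, map_zero]
    · rw [h0, coord_cls, if_neg]
      rintro rfl
      exact hq ⟨_, hs⟩
  exact LinearMap.congr_fun this x

theorem coord_arrow_mul_eq_zero {q : NonzeroPath I} {d : Arrow V}
    (hq : ¬ ∃ t, arr q.1.2.2 = d :: t) (x : QuotAlg I) :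
    hI.pathBasis.coord q (cls I d.toQPath * x) = 0 := by
  have : hI.pathBasis.coord q ∘ₗ LinearMap.mulLeft k (cls I d.toQPath) = 0 := by
    refine hI.pathBasis.ext fun r => ?_
    rw [LinearMap.comp_apply, LinearMap.mulLeft_apply, pathBasis_apply, LinearMap.zero_apply]
    rcases cls_mul_cases I d.toQPath r.1 with ⟨h, h0⟩ | ⟨s, hs, h0⟩
    · rw [h0, map_zero]
    · rw [h0, coord_cls, if_neg]
      rintro rfl
      exact hq ⟨_, hs⟩
  exact LinearMap.congr_fun this x

theorem coord_trivial_mul_trivial {q : NonzeroPath I} {a b : V} (h : ¬ (q.1.1 = a ∧ q.1.2.1 = b))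
    (x : QuotAlg I) :
    hI.pathBasis.coord q (cls I (trivialPath a) * x * cls I (trivialPath b)) = 0 := by
  have : hI.pathBasis.coord q ∘ₗ LinearMap.mulRight k (cls I (trivialPath b)) ∘ₗ
      LinearMap.mulLeft k (cls I (trivialPath a)) = 0 := by
    refine hI.pathBasis.ext fun r => ?_
    rw [LinearMap.comp_apply, LinearMap.comp_apply, LinearMap.mulLeft_apply,
      LinearMap.mulRight_apply, pathBasis_apply, LinearMap.zero_apply]
    by_cases h1 : r.1.1 = a
    · by_cases h2 : r.1.2.1 = b
      · subst h1 h2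
        rw [trivial_mul_cls, cls_mul_trivial, coord_cls, if_neg]
        rintro h3
        exact h (by rw [h3]; exact ⟨rfl, rfl⟩)
      · rw [mul_assoc, cls_mul_ne _ _ h2, mul_zero, map_zero]
    · rw [cls_mul_ne _ _ (Ne.symm h1), zero_mul, map_zero]
  exact LinearMap.congr_fun this x

variable (hcyc : NoOrientedCycles V) (hpar : NoParallelArrows V)

/-- The values of a cocycle are combinations of the permitted paths. -/
theorem IsTwoCocycle.mem_span {f : BardzellOne I} (hf : IsTwoCocycle f) (ω : AP2 I) :
    f.1 ω ∈ Submodule.span k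
      (ev I '' {z | (hI.boundQuiver hcyc hpar).Perm ω.1.1 ω.1.2 z}) := by
  obtain ⟨⟨s, y⟩, hr⟩ := ω
  dsimp only
  have h0 := hI.pathBasis.mem_span_repr_support (f.1 ⟨(s, y), hr⟩)
  refine Submodule.span_le.2 ?_ h0
  rintro _ ⟨p, hp, rfl⟩
  rw [Finset.mem_coe, Finsupp.mem_support_iff, ← Module.Basis.coord_apply] at hp
  rw [pathBasis_apply]
  have hst : p.1.1 = s.src ∧ p.1.2.1 = y.tgt := by
    by_contra h
    refine hp ?_
    rw [← f.2 ⟨(s, y), hr⟩]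
    exact coord_trivial_mul_trivial hI h _
  have hw := walk_arr hI hcyc hpar p.1 hst.1 hst.2
  have hne : arr p.1.2.2 ≠ [] := by
    intro h
    rw [h] at hw
    have hw' : s.src = y.tgt := hw
    refine (hI.boundQuiver hcyc hpar).not_conn s ⟨?_⟩
    change Path s.tgt s.src
    rw [hw', hr.1]
    exact y.2.2.toPath
  have hn := nz_arr hI hcyc hpar p.2
  refine Submodule.subset_span ⟨arr p.1.2.2, ⟨hne, hn, hw, ?_⟩, (cls_eq_ev hne).symm⟩
  by_contra! hc
  obtain ⟨hcs, hcy, hiso⟩ := hc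
  have hcs' : ¬ ∃ t, arr p.1.2.2 = s :: t := fun ⟨t, h⟩ => hcs t h
  have hcy' : ¬ ∃ t, arr p.1.2.2 = t ++ [y] := fun ⟨t, h⟩ => hcy t h
  -- Suppose that `p` neither starts with `s` nor ends with `y`, and that `s y` is part of an
  -- overlap. For a relation `c s`, the path `c p` is nonzero, and its coefficient in `c f(s, y)` is
  -- that of `p` in `f(s, y)`. It does not occur in `f(c, s) y`, since `p` does not end with `y`.
  -- For a relation `y d` the argument is symmetric, with `p d`.
  by_cases hd : ∀ d, ¬ (hI.boundQuiver hcyc hpar).Rel y d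
  · obtain ⟨c, hc⟩ := hiso hd
    have hc : IsRel I c s := hc
    obtain ⟨b, L, hL⟩ : ∃ b L, arr p.1.2.2 = b :: L := List.exists_cons_of_ne_nil hne
    have hnq : (hI.boundQuiver hcyc hpar).NZ (c :: arr p.1.2.2) := by
      rw [hL, BoundQuiver.nz_cons_cons, ← hL]
      refine ⟨BoundQuiver.non_of_not_rel ?_ fun h => hcs L ?_, hn⟩
      · have := src_eq_of_arr hL
        exact hc.1.trans (hst.1.symm.trans this)
      · rw [hL, hI.rel_right _ _ _ hc h]
    obtain ⟨q, hq⟩ := exists_path_of_nz hI hcyc hpar hnq (by simp)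
    have hq0 := cls_ne_zero hI hcyc hpar (hq ▸ hnq : (hI.boundQuiver hcyc hpar).NZ (arr q.2.2))
    have hδ := sub_eq_zero.1 (hf ⟨(c, s, y), hc, hr⟩)
    refine hp ?_
    rw [← coord_arrow_mul hI (q := ⟨q, hq0⟩) hne (hc.1.trans hst.1.symm) hq]
    refine (congrArg _ hδ).trans (coord_mul_arrow_eq_zero hI ?_ _)
    rintro ⟨t, ht⟩
    dsimp only at ht
    rw [hq, hL] at ht
    obtain ⟨L', e, hL'⟩ : ∃ L' e, b :: L = L' ++ [e] := by
      rcases List.eq_nil_or_concat (b :: L) with h | ⟨L', e, h⟩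
      · simp at h
      · exact ⟨L', e, by simpa using h⟩
    rw [hL', ← List.cons_append] at ht
    obtain rfl : e = y := by simpa using (List.append_inj' ht rfl).2
    exact hcy' ⟨L', hL.trans hL'⟩
  · push Not at hd
    obtain ⟨d, hd⟩ := hd
    have hd : IsRel I y d := hd
    obtain ⟨L, b, hL⟩ : ∃ L b, arr p.1.2.2 = L ++ [b] := by
      rcases List.eq_nil_or_concat (arr p.1.2.2) with h | ⟨L', e, h⟩
      · exact (hne h).elim
      · exact ⟨L', e, by simpa using h⟩
    have hnq : (hI.boundQuiver hcyc hpar).NZ (arr p.1.2.2 ++ [d]) := by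
      rw [hL, List.append_assoc, List.singleton_append, BoundQuiver.nz_split, ← hL]
      refine ⟨hn, BoundQuiver.non_of_not_rel ?_ fun h => hcy L ?_, by simp⟩
      · have := tgt_eq_of_arr hL
        exact this.symm.trans (hst.2.trans hd.1)
      · rw [hL, hI.rel_left _ _ _ hd h]
    obtain ⟨q, hq⟩ := exists_path_of_nz hI hcyc hpar hnq (by simp)
    have hq0 := cls_ne_zero hI hcyc hpar (hq ▸ hnq : (hI.boundQuiver hcyc hpar).NZ (arr q.2.2))
    have hδ := sub_eq_zero.1 (hf ⟨(s, y, d), hr, hd⟩)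
    refine hp ?_
    rw [← coord_mul_arrow hI (q := ⟨q, hq0⟩) hne (hst.2.trans hd.1) hq]
    refine (congrArg _ hδ.symm).trans (coord_arrow_mul_eq_zero hI ?_ _)
    rintro ⟨t, ht⟩
    dsimp only at ht
    obtain ⟨e, L', hL'⟩ : ∃ b L, arr p.1.2.2 = b :: L := List.exists_cons_of_ne_nil hne
    rw [hq, hL', List.cons_append, List.cons.injEq] at ht
    obtain ⟨rfl, -⟩ := ht
    exact hcs' ⟨L', hL'⟩

end Coordinates

section Support

variable {k V : Type*} [Field k] [Quiver V] [Fintype V] {I : TwoSidedIdeal (PathAlgebra k V)}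

/-! ### The maps `G^*` and `H^*` on paths -/

theorem hat_tmul {W : Type*} [AddCommGroup W] [Module k W] (g : W →ₗ[k] QuotAlg I)
    (a b : QuotAlg I) (w : W) : hat I g (a ⊗ₜ[k] (w ⊗ₜ[k] b)) = a * (g w * b) := by
  simp [hat]

theorem circ_tmul (g h : HochTwo I) (a b c : QuotAlg I) :
    circ g h (a ⊗ₜ[k] (b ⊗ₜ[k] c)) = g (h (a ⊗ₜ[k] b) ⊗ₜ[k] c) - g (a ⊗ₜ[k] h (b ⊗ₜ[k] c)) := by
  simp [circ]

theorem trivial_mul_trivial (v : V) :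
    cls I (trivialPath v) * cls I (trivialPath v) = cls I (trivialPath v) :=
  trivial_mul_cls (trivialPath v)

theorem trivial_mul_value (f : BardzellOne I) (ω : AP2 I) :
    cls I (trivialPath ω.1.1.src) * f.1 ω = f.1 ω := by
  calc cls I (trivialPath ω.1.1.src) * f.1 ω
      = cls I (trivialPath ω.1.1.src) *
        (cls I (trivialPath ω.1.1.src) * f.1 ω * cls I (trivialPath ω.1.2.tgt)) := by rw [f.2 ω]
    _ = cls I (trivialPath ω.1.1.src) * f.1 ω * cls I (trivialPath ω.1.2.tgt) := by
      rw [← mul_assoc, ← mul_assoc, trivial_mul_trivial]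
    _ = f.1 ω := f.2 ω

theorem value_mul_trivial (f : BardzellOne I) (ω : AP2 I) :
    f.1 ω * cls I (trivialPath ω.1.2.tgt) = f.1 ω := by
  calc f.1 ω * cls I (trivialPath ω.1.2.tgt)
      = cls I (trivialPath ω.1.1.src) * f.1 ω * cls I (trivialPath ω.1.2.tgt) *
        cls I (trivialPath ω.1.2.tgt) := by rw [f.2 ω]
    _ = cls I (trivialPath ω.1.1.src) * f.1 ω * cls I (trivialPath ω.1.2.tgt) := by
      rw [mul_assoc, trivial_mul_trivial]
    _ = f.1 ω := f.2 ω

theorem ext_left {φ ψ : HochTwo I} {x : QuotAlg I} (h : ∀ p, φ (x ⊗ₜ[k] cls I p) = ψ (x ⊗ₜ[k] cls I p))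
    (y : QuotAlg I) : φ (x ⊗ₜ[k] y) = ψ (x ⊗ₜ[k] y) := by
  have hy := span_cls I (Submodule.mem_top : y ∈ ⊤)
  induction hy using Submodule.span_induction with
  | zero => simp
  | add y₁ y₂ _ _ h₁ h₂ => rw [tmul_add, map_add, map_add, h₁, h₂]
  | smul c y _ h => rw [tmul_smul, map_smul, map_smul, h]
  | mem y hy => obtain ⟨p, rfl⟩ := hy; exact h p.1

theorem ext_right {φ ψ : HochTwo I} {x : QuotAlg I}
    (h : ∀ p, φ (cls I p ⊗ₜ[k] x) = ψ (cls I p ⊗ₜ[k] x))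
    (y : QuotAlg I) : φ (y ⊗ₜ[k] x) = ψ (y ⊗ₜ[k] x) := by
  have hy := span_cls I (Submodule.mem_top : y ∈ ⊤)
  induction hy using Submodule.span_induction with
  | zero => simp
  | add y₁ y₂ _ _ h₁ h₂ => rw [add_tmul, map_add, map_add, h₁, h₂]
  | smul c y _ h => rw [← smul_tmul', map_smul, map_smul, h]
  | mem y hy => obtain ⟨p, rfl⟩ := hy; exact h p.1

variable (hI : IsGentle I)

theorem G2_cls {p q : QPath V} (hp : cls I p ≠ 0) (hq : cls I q ≠ 0) :
    G2 hI (cls I p ⊗ₜ[k] cls I q) = G2path I p q := by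
  have h := (hI.pathBasis.tensorProduct hI.pathBasis).constr_basis k
    (fun p => G2path I p.1.1 p.2.1) (⟨p, hp⟩, ⟨q, hq⟩)
  rwa [Module.Basis.tensorProduct_apply, pathBasis_apply, pathBasis_apply] at h

theorem H2_cls {p q : QPath V} (hp : cls I p ≠ 0) (hq : cls I q ≠ 0) :
    H2 hI (cls I p ⊗ₜ[k] cls I q) = H2path I p q := by
  have h := (hI.pathBasis.tensorProduct hI.pathBasis).constr_basis k
    (fun p => H2path I p.1.1 p.2.1) (⟨p, hp⟩, ⟨q, hq⟩)
  rwa [Module.Basis.tensorProduct_apply, pathBasis_apply, pathBasis_apply] at h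

theorem G2_trivial_left (v : V) (p : QPath V) :
    G2 hI (cls I (trivialPath v) ⊗ₜ[k] cls I p) = 0 := by
  by_cases hv : cls I (trivialPath v) = 0
  · rw [hv, zero_tmul, map_zero]
  by_cases hp : cls I p = 0
  · rw [hp, tmul_zero, map_zero]
  rw [G2_cls hI hv hp, G2path, splits_trivial]
  rfl

theorem G2_trivial_right (v : V) (p : QPath V) :
    G2 hI (cls I p ⊗ₜ[k] cls I (trivialPath v)) = 0 := by
  by_cases hv : cls I (trivialPath v) = 0
  · rw [hv, tmul_zero, map_zero]
  by_cases hp : cls I p = 0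
  · rw [hp, zero_tmul, map_zero]
  rw [G2_cls hI hp hv, G2path, splits_trivial]
  cases p.splits.getLast? <;> rfl

theorem H2_trivial_left (v : V) (p : QPath V) :
    H2 hI (cls I (trivialPath v) ⊗ₜ[k] cls I p) = 0 := by
  by_cases hv : cls I (trivialPath v) = 0
  · rw [hv, zero_tmul, map_zero]
  by_cases hp : cls I p = 0
  · rw [hp, tmul_zero, map_zero]
  rw [H2_cls hI hv hp, H2path, splits_trivial]
  rfl

theorem H2_trivial_right (v : V) (p : QPath V) :
    H2 hI (cls I p ⊗ₜ[k] cls I (trivialPath v)) = 0 := by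
  by_cases hv : cls I (trivialPath v) = 0
  · rw [hv, tmul_zero, map_zero]
  by_cases hp : cls I p = 0
  · rw [hp, zero_tmul, map_zero]
  rw [H2_cls hI hp hv, H2path, splits_trivial]
  cases p.splits.getLast? <;> rfl

variable (hcyc : NoOrientedCycles V) (hpar : NoParallelArrows V)

theorem GStar_ev (f : BardzellOne I) {u v : List (Arrow V)} {β γ : Arrow V}
    (hu : (hI.boundQuiver hcyc hpar).NZ (u ++ [β])) (hv : (hI.boundQuiver hcyc hpar).NZ (γ :: v)) :
    GStar hI f (ev I (u ++ [β]) ⊗ₜ[k] ev I (γ :: v)) =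
      if h : IsRel I β γ then ev I u * f.1 ⟨(β, γ), h⟩ * ev I v else 0 := by
  obtain ⟨p, hp⟩ := exists_path_of_nz hI hcyc hpar hu (by simp)
  obtain ⟨q, hq⟩ := exists_path_of_nz hI hcyc hpar hv (by simp)
  have hp0 := cls_ne_zero hI hcyc hpar (hp ▸ hu : (hI.boundQuiver hcyc hpar).NZ (arr p.2.2))
  have hq0 := cls_ne_zero hI hcyc hpar (hq ▸ hv : (hI.boundQuiver hcyc hpar).NZ (arr q.2.2))
  have hpn : arr p.2.2 ≠ [] := by rw [hp]; simp
  have hqn : arr q.2.2 ≠ [] := by rw [hq]; simp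
  rw [← hp, ← hq, ← cls_eq_ev hpn, ← cls_eq_ev hqn, GStar, LinearMap.comp_apply,
    G2_cls hI hp0 hq0, G2path]
  obtain ⟨a, b, c, p', e, rfl, hp', rfl⟩ := exists_cons_of_arr hp
  obtain ⟨y, T, hT, h1, h2, -⟩ := splits_cons hqn
  rw [splits_getLast, hT]
  rw [hq, List.cons.injEq] at h1
  obtain ⟨rfl, rfl⟩ := h1
  simp only [List.head?_cons]
  by_cases h : IsRel I ⟨b, c, e⟩ y.2.1
  · simp only [dif_pos h]
    rw [hat_tmul, Finsupp.linearCombination_single, one_smul, cls_eq_ev_mul_trivial,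
      cls_eq_trivial_mul_ev y.2.2,
      show cls I (trivialPath y.2.2.1) = cls I (trivialPath y.2.1.tgt) by rw [h2]]
    have e1 := trivial_mul_value f ⟨(⟨b, c, e⟩, y.2.1), h⟩
    have e2 := value_mul_trivial f ⟨(⟨b, c, e⟩, y.2.1), h⟩
    dsimp only at e1 e2
    change ev I (arr p') * cls I (trivialPath b) * _ = _
    change cls I (trivialPath b) * _ = _ at e1
    rw [hp', ← mul_assoc (f.1 _), e2, mul_assoc, ← mul_assoc (cls I (trivialPath b)), e1, mul_assoc]
  · simp only [dif_neg h, map_zero]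

/-- The outer factors are kept as paths `p`, `q` instead of words because they may be trivial. The
condition `L ≠ []` reflects that the sum in the homotopy starts at `i = 2`. -/
theorem HStar_mem {S : Submodule k (QuotAlg I)} (W : HochThree I) {u v : List (Arrow V)}
    {β γ : Arrow V} (hu : (hI.boundQuiver hcyc hpar).NZ (u ++ [β]))
    (hv : (hI.boundQuiver hcyc hpar).NZ (γ :: v))
    (h1 : IsRel I β γ → ∀ p q : QPath V, arr p.2.2 = u → arr q.2.2 = v →
      W (cls I p ⊗ₜ[k] (ev I [β] ⊗ₜ[k] ev I [γ])) * cls I q ∈ S)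
    (h2 : ∀ (L : List (Arrow V)) (d : Arrow V) (q : QPath V), L ≠ [] →
      γ :: v = L ++ d :: arr q.2.2 →
      W (ev I (u ++ [β]) ⊗ₜ[k] (ev I L ⊗ₜ[k] ev I [d])) * cls I q ∈ S) :
    HStar hI W (ev I (u ++ [β]) ⊗ₜ[k] ev I (γ :: v)) ∈ S := by
  obtain ⟨p, hp⟩ := exists_path_of_nz hI hcyc hpar hu (by simp)
  obtain ⟨q, hq⟩ := exists_path_of_nz hI hcyc hpar hv (by simp)
  have hp0 := cls_ne_zero hI hcyc hpar (hp ▸ hu : (hI.boundQuiver hcyc hpar).NZ (arr p.2.2))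
  have hq0 := cls_ne_zero hI hcyc hpar (hq ▸ hv : (hI.boundQuiver hcyc hpar).NZ (arr q.2.2))
  have hpn : arr p.2.2 ≠ [] := by rw [hp]; simp
  have hqn : arr q.2.2 ≠ [] := by rw [hq]; simp
  rw [← hp, ← cls_eq_ev hpn] at h2
  rw [← hp, ← hq, ← cls_eq_ev hpn, ← cls_eq_ev hqn, HStar, LinearMap.comp_apply,
    H2_cls hI hp0 hq0, H2path]
  have hpl : ∃ x, p.splits.getLast? = some x ∧ arr x.1.2.2 = u ∧ x.2.1 = β := by
    obtain ⟨a, b, c, p', e, rfl, hp', rfl⟩ := exists_cons_of_arr hp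
    exact ⟨_, splits_getLast p' e, hp', rfl⟩
  obtain ⟨x, hx, hxu, rfl⟩ := hpl
  obtain ⟨y, T, hT, h3, -, h4⟩ := splits_cons hqn
  rw [hx, hT]
  rw [hq, List.cons.injEq] at h3
  obtain ⟨rfl, rfl⟩ := h3
  simp only [List.head?_cons, List.tail_cons]
  rw [map_sub]
  refine S.sub_mem ?_ ?_
  · split_ifs with h
    · rw [hat_tmul, one_mul]
      simpa using h1 h x.1 y.2.2 hxu rfl
    · rw [map_zero]; exact S.zero_mem
  · rw [map_list_sum]
    refine S.list_sum_mem fun z hz => ?_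
    simp only [List.map_map, List.mem_map, Function.comp_apply] at hz
    obtain ⟨z, hz, rfl⟩ := hz
    obtain ⟨h5, h6⟩ := h4 z hz
    rw [hat_tmul, one_mul, cls_eq_ev h5]
    simpa using h2 _ _ _ h5 (hq.symm.trans h6)

/-! ### Support of the maps `φₙ` -/

/-- The span of the nonzero paths obtained from `L` by `n` replacements. -/
def reachSpan (n : ℕ) (L : List (Arrow V)) : Submodule k (QuotAlg I) :=
  Submodule.span k (ev I '' {w | w ≠ [] ∧ (hI.boundQuiver hcyc hpar).NZ w ∧
    (hI.boundQuiver hcyc hpar).Reach n L w})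

theorem ev_mem_reachSpan {n : ℕ} {L w : List (Arrow V)} (hw : w ≠ [])
    (h : (hI.boundQuiver hcyc hpar).Reach n L w) : ev I w ∈ reachSpan hI hcyc hpar n L := by
  by_cases hn : (hI.boundQuiver hcyc hpar).NZ w
  · exact Submodule.subset_span ⟨w, ⟨hw, hn, h⟩, rfl⟩
  · rw [ev_eq_zero hI hcyc hpar hn]; exact Submodule.zero_mem _

theorem ev_mul_cls {w : List (Arrow V)} (hw : w ≠ []) (q : QPath V) :
    ev I w * cls I q = 0 ∨ ev I w * cls I q = ev I (w ++ arr q.2.2) := by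
  rcases List.eq_nil_or_concat w with rfl | ⟨w, a, rfl⟩
  · exact (hw rfl).elim
  rw [List.concat_eq_append, ev_append, ev_cons, ev_nil, mul_one, mul_assoc]
  rcases cls_mul_cases I a.toQPath q with ⟨-, h⟩ | ⟨s, hs, h⟩
  · left; rw [h, mul_zero]
  · right
    rw [h, cls_eq_ev (by rw [hs]; simp [arr_toQPath]), hs, arr_toQPath, ← ev_append,
      List.append_assoc]

/-- Replacements made in `L` remain leftmost after a path is appended. -/
theorem reachSpan_mul_cls {n : ℕ} {L : List (Arrow V)} {x : QuotAlg I}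
    (hx : x ∈ reachSpan hI hcyc hpar n L) (q : QPath V) :
    x * cls I q ∈ reachSpan hI hcyc hpar n (L ++ arr q.2.2) := by
  induction hx using Submodule.span_induction with
  | zero => rw [zero_mul]; exact Submodule.zero_mem _
  | add y₁ y₂ _ _ h₁ h₂ => rw [add_mul]; exact Submodule.add_mem _ h₁ h₂
  | smul c y _ h => rw [smul_mul_assoc]; exact Submodule.smul_mem _ _ h
  | mem y hy =>
    obtain ⟨w, ⟨hw, hn, hr⟩, rfl⟩ := hy
    rcases ev_mul_cls (I := I) hw q with h | h
    · rw [h]; exact Submodule.zero_mem _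
    · rw [h]
      exact ev_mem_reachSpan hI hcyc hpar (by simp [hw]) (hr.append_right _)

theorem map_mem_of_span {S : Submodule k (QuotAlg I)} (F : QuotAlg I →ₗ[k] QuotAlg I)
    {T : Set (List (Arrow V))} {x : QuotAlg I} (hx : x ∈ Submodule.span k (ev I '' T))
    (h : ∀ w ∈ T, F (ev I w) ∈ S) : F x ∈ S := by
  have : Submodule.span k (ev I '' T) ≤ S.comap F := by
    refine Submodule.span_le.2 ?_
    rintro _ ⟨w, hw, rfl⟩
    exact h w hw
  exact this hx

/-- A Hochschild cochain which vanishes on trivial paths, and sends a pair of paths to a combination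
of paths obtained from their concatenation by `n` replacements. -/
structure Supported (n : ℕ) (φ : HochTwo I) : Prop where
  left : ∀ v x, φ (cls I (trivialPath v) ⊗ₜ[k] x) = 0
  right : ∀ v x, φ (x ⊗ₜ[k] cls I (trivialPath v)) = 0
  mem : ∀ L M, L ≠ [] → M ≠ [] → (hI.boundQuiver hcyc hpar).NZ L →
    (hI.boundQuiver hcyc hpar).NZ M → φ (ev I L ⊗ₜ[k] ev I M) ∈ reachSpan hI hcyc hpar n (L ++ M)

variable {hI hcyc hpar}

theorem Supported.eq_zero {n : ℕ} {φ : HochTwo I} (h : Supported hI hcyc hpar n φ) (hn : n ≠ 0)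
    {L M : List (Arrow V)} (hL : L ≠ []) (hM : M ≠ [])
    (hLM : (hI.boundQuiver hcyc hpar).NZ (L ++ M)) : φ (ev I L ⊗ₜ[k] ev I M) = 0 := by
  have h1 := h.mem L M hL hM hLM.left hLM.right
  have h2 : reachSpan hI hcyc hpar n (L ++ M) = ⊥ := by
    rw [reachSpan, Submodule.span_eq_bot]
    rintro _ ⟨w, ⟨-, -, hw⟩, rfl⟩
    exact (hLM.not_reach hn hw).elim
  rwa [h2, Submodule.mem_bot] at h1

theorem Supported.rel_mem {n : ℕ} {φ : HochTwo I} (h : Supported hI hcyc hpar n φ) (hn : n ≠ 0)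
    {β γ : Arrow V} (hr : IsRel I β γ) : φ (ev I [β] ⊗ₜ[k] ev I [γ]) ∈ Submodule.span k
      (ev I '' {z | n = 1 ∧ (hI.boundQuiver hcyc hpar).Perm β γ z}) := by
  refine Submodule.span_mono (Set.image_mono ?_) (h.mem [β] [γ] (by simp) (by simp) (by simp)
    (by simp))
  rintro w ⟨-, hw, hz⟩
  exact BoundQuiver.Perm.reach_one (B := hI.boundQuiver hcyc hpar) hr hz hn hw

/-- The summand with `h(p ⊗ β)` vanishes, because `p β` contains no relation or `p` is trivial. In
the other one, `h(β ⊗ γ)` forces `n = 1` and is a replacement at the leftmost relation of `p β γ q`;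
the map `g` then adds `m` more. -/
theorem Supported.circ_mem_of_rel {m n : ℕ} {g h : HochTwo I} (hg : Supported hI hcyc hpar m g)
    (hh : Supported hI hcyc hpar n h) (hn : n ≠ 0) {β γ : Arrow V} (hr : IsRel I β γ)
    {p q : QPath V} (hp : (hI.boundQuiver hcyc hpar).NZ (arr p.2.2 ++ [β])) :
    circ g h (cls I p ⊗ₜ[k] (ev I [β] ⊗ₜ[k] ev I [γ])) * cls I q ∈
      reachSpan hI hcyc hpar (m + n) (arr p.2.2 ++ [β] ++ γ :: arr q.2.2) := by
  rw [circ_tmul]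
  by_cases hp0 : arr p.2.2 = []
  · obtain ⟨v, rfl⟩ := eq_trivial_of_arr hp0
    rw [hh.left, zero_tmul, map_zero, hg.left, sub_zero, zero_mul]
    exact Submodule.zero_mem _
  rw [cls_eq_ev hp0, hh.eq_zero hn hp0 (by simp) hp, zero_tmul, map_zero, zero_sub, neg_mul]
  refine Submodule.neg_mem _ ?_
  refine map_mem_of_span (LinearMap.mulRight k (cls I q) ∘ₗ g ∘ₗ
    TensorProduct.mk k _ _ (ev I (arr p.2.2))) (hh.rel_mem hn hr) ?_
  rintro z ⟨rfl, hz⟩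
  rw [LinearMap.comp_apply, LinearMap.comp_apply, LinearMap.mulRight_apply, mk_apply]
  have h1 := reachSpan_mul_cls hI hcyc hpar (hg.mem _ z hp0 hz.1 hp.left hz.2.1) q
  refine Submodule.span_mono (Set.image_mono ?_) h1
  rintro w ⟨hw0, hw, hwr⟩
  refine ⟨hw0, hw, _, ⟨arr p.2.2, β, γ, z, arr q.2.2, by simp, rfl, hp, hr, hz⟩, ?_⟩
  rwa [List.append_assoc] at hwr

/-- Here `h(M ⊗ d)` vanishes, and in the other summand the `n` replacements inside `L M` precede the
`m` ones made by `g`. -/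
theorem Supported.circ_mem_of_nz {m n : ℕ} {g h : HochTwo I} (hg : Supported hI hcyc hpar m g)
    (hh : Supported hI hcyc hpar n h) (hn : n ≠ 0) {L M : List (Arrow V)} {d : Arrow V}
    {q : QPath V} (hL0 : L ≠ []) (hM0 : M ≠ []) (hL : (hI.boundQuiver hcyc hpar).NZ L)
    (hM : (hI.boundQuiver hcyc hpar).NZ (M ++ [d])) :
    circ g h (ev I L ⊗ₜ[k] (ev I M ⊗ₜ[k] ev I [d])) * cls I q ∈
      reachSpan hI hcyc hpar (m + n) (L ++ (M ++ d :: arr q.2.2)) := by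
  rw [circ_tmul, hh.eq_zero hn hM0 (by simp) hM, tmul_zero, map_zero, sub_zero]
  refine map_mem_of_span (LinearMap.mulRight k (cls I q) ∘ₗ g ∘ₗ
    (TensorProduct.mk k _ _).flip (ev I [d])) (hh.mem L M hL0 hM0 hL hM.left) ?_
  rintro z ⟨hz0, hz, hzr⟩
  rw [LinearMap.comp_apply, LinearMap.comp_apply, LinearMap.mulRight_apply, LinearMap.flip_apply,
    mk_apply]
  have h1 := reachSpan_mul_cls hI hcyc hpar (hg.mem z [d] hz0 (by simp) hz (by simp)) q
  refine Submodule.span_mono (Set.image_mono ?_) h1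
  rintro w ⟨hw0, hw, hwr⟩
  refine ⟨hw0, hw, ?_⟩
  rw [Nat.add_comm]
  refine BoundQuiver.Reach.trans ?_ hwr
  simpa using hzr.append_right (d :: arr q.2.2)

variable (hI hcyc hpar)

theorem supported_GStar {f : BardzellOne I} (hf : IsTwoCocycle f) :
    Supported hI hcyc hpar 1 (GStar hI f) where
  left v := ext_left (ψ := 0) fun p => by
    rw [GStar, LinearMap.comp_apply, G2_trivial_left, map_zero, LinearMap.zero_apply]
  right v := ext_right (ψ := 0) fun p => by
    rw [GStar, LinearMap.comp_apply, G2_trivial_right, map_zero, LinearMap.zero_apply]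
  mem L M hL0 hM0 hL hM := by
    rcases List.eq_nil_or_concat L with rfl | ⟨u, β, rfl⟩
    · exact (hL0 rfl).elim
    rcases M with _ | ⟨γ, v⟩
    · exact (hM0 rfl).elim
    rw [List.concat_eq_append] at *
    rw [GStar_ev hI hcyc hpar f hL hM]
    split_ifs with hr
    · refine map_mem_of_span (LinearMap.mulRight k (ev I v) ∘ₗ LinearMap.mulLeft k (ev I u))
        (hf.mem_span hI hcyc hpar ⟨(β, γ), hr⟩) ?_
      intro z hz
      rw [LinearMap.comp_apply, LinearMap.mulRight_apply, LinearMap.mulLeft_apply, ← ev_append,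
        ← ev_append]
      refine ev_mem_reachSpan hI hcyc hpar (by simp [hz.1]) ⟨_, ?_, rfl⟩
      exact ⟨u, β, γ, z, v, by simp, by simp, hL, hr, hz⟩
    · exact Submodule.zero_mem _

theorem supported_HStar {n : ℕ} {W : HochThree I}
    (h1 : ∀ (p q : QPath V) (β γ : Arrow V), IsRel I β γ →
      (hI.boundQuiver hcyc hpar).NZ (arr p.2.2 ++ [β]) →
      W (cls I p ⊗ₜ[k] (ev I [β] ⊗ₜ[k] ev I [γ])) * cls I q ∈
        reachSpan hI hcyc hpar n (arr p.2.2 ++ [β] ++ γ :: arr q.2.2))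
    (h2 : ∀ (L M : List (Arrow V)) (d : Arrow V) (q : QPath V), L ≠ [] → M ≠ [] →
      (hI.boundQuiver hcyc hpar).NZ L → (hI.boundQuiver hcyc hpar).NZ (M ++ [d]) →
      W (ev I L ⊗ₜ[k] (ev I M ⊗ₜ[k] ev I [d])) * cls I q ∈
        reachSpan hI hcyc hpar n (L ++ (M ++ d :: arr q.2.2))) :
    Supported hI hcyc hpar n (HStar hI W) where
  left v := ext_left (ψ := 0) fun p => by
    rw [HStar, LinearMap.comp_apply, H2_trivial_left, map_zero, LinearMap.zero_apply]
  right v := ext_right (ψ := 0) fun p => by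
    rw [HStar, LinearMap.comp_apply, H2_trivial_right, map_zero, LinearMap.zero_apply]
  mem L M hL0 hM0 hL hM := by
    rcases List.eq_nil_or_concat L with rfl | ⟨u, β, rfl⟩
    · exact (hL0 rfl).elim
    rcases M with _ | ⟨γ, v⟩
    · exact (hM0 rfl).elim
    rw [List.concat_eq_append] at *
    refine HStar_mem hI hcyc hpar W hL hM ?_ ?_
    · rintro hr p q rfl rfl
      exact h1 p q β γ hr hL
    · intro M d q hM' hd
      rw [hd] at hM ⊢
      exact h2 _ M d q hL0 hM' hL (BoundQuiver.nz_glue.1 hM).1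

/-- The signs and shuffles play no role for membership in a submodule; only the brackets `[φ_t,
φ_s]` with `t + s = n` matter. -/
theorem vMap_mem {T : Submodule k (HochThree I)} {n : ℕ} {f : Fin n → BardzellOne I}
    (h : ∀ (t s : ℕ) (a : Fin t → BardzellOne I) (b : Fin s → BardzellOne I), t ≠ 0 → s ≠ 0 →
      t + s = n → (∀ i, ∃ j, a i = f j) → (∀ i, ∃ j, b i = f j) →
      bracket (phiMap hI t a) (phiMap hI s b) ∈ T) :
    vMap hI n f ∈ T := by
  obtain _ | _ | m := n
  · rw [vMap]; exact T.zero_mem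
  · rw [vMap]; exact T.zero_mem
  · rw [vMap]
    refine T.sum_mem fun s _ => T.sum_mem fun τ _ => T.smul_mem _ ?_
    exact h _ _ _ _ (by omega) (by omega) (by omega) (fun i => ⟨_, rfl⟩) (fun i => ⟨_, rfl⟩)

/-- The submodule of the cochains whose value at `x`, multiplied by `c`, lies in `S`. -/
def valueSubmodule (S : Submodule k (QuotAlg I))
    (x : QuotAlg I ⊗[k] (QuotAlg I ⊗[k] QuotAlg I)) (c : QuotAlg I) : Submodule k (HochThree I) :=
  S.comap (LinearMap.mulRight k c ∘ₗ LinearMap.applyₗ x)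

theorem mem_valueSubmodule {S : Submodule k (QuotAlg I)}
    {x : QuotAlg I ⊗[k] (QuotAlg I ⊗[k] QuotAlg I)} {c : QuotAlg I} {W : HochThree I} :
    W ∈ valueSubmodule S x c ↔ W x * c ∈ S := Iff.rfl

/-- The homotopy only regroups the arrows of `u v` into three blocks and a right factor, so it makes
no replacement. Each composition in `vₙ` adds the numbers of replacements of its two constituents.
-/
theorem supported_phiMap (n : ℕ) (hn : n ≠ 0) (f : Fin n → BardzellOne I)
    (hf : ∀ i, IsTwoCocycle (f i)) : Supported hI hcyc hpar n (phiMap hI n f) := by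
  induction n using Nat.strong_induction_on with
  | _ n ih =>
    obtain _ | _ | m := n
    · exact (hn rfl).elim
    · rw [phiMap]
      exact supported_GStar hI hcyc hpar (hf 0)
    · rw [phiMap]
      have key : ∀ (t s : ℕ) (a : Fin t → BardzellOne I) (b : Fin s → BardzellOne I), t ≠ 0 →
          s ≠ 0 → t + s = m + 2 → (∀ i, ∃ j, a i = f j) → (∀ i, ∃ j, b i = f j) →
          Supported hI hcyc hpar t (phiMap hI t a) ∧ Supported hI hcyc hpar s (phiMap hI s b) := by
        intro t s a b ht hs hts ha hb
        refine ⟨ih t (by omega) ht a fun i => ?_, ih s (by omega) hs b fun i => ?_⟩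
        · obtain ⟨j, hj⟩ := ha i
          rw [hj]; exact hf j
        · obtain ⟨j, hj⟩ := hb i
          rw [hj]; exact hf j
      refine supported_HStar hI hcyc hpar (fun p q β γ hr hp => ?_)
        (fun L M d q hL0 hM0 hL hM => ?_)
      · rw [← mem_valueSubmodule]
        refine vMap_mem hI fun t s a b ht hs hts ha hb => ?_
        obtain ⟨h1, h2⟩ := key t s a b ht hs hts ha hb
        refine Submodule.add_mem _ ?_ ?_
        · rw [mem_valueSubmodule, ← hts]
          exact h1.circ_mem_of_rel h2 hs hr hp
        · rw [mem_valueSubmodule, ← hts, add_comm]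
          exact h2.circ_mem_of_rel h1 ht hr hp
      · rw [← mem_valueSubmodule]
        refine vMap_mem hI fun t s a b ht hs hts ha hb => ?_
        obtain ⟨h1, h2⟩ := key t s a b ht hs hts ha hb
        refine Submodule.add_mem _ ?_ ?_
        · rw [mem_valueSubmodule, ← hts]
          exact h1.circ_mem_of_nz h2 hs hL0 hM0 hL hM
        · rw [mem_valueSubmodule, ← hts, add_comm]
          exact h2.circ_mem_of_nz h1 ht hL0 hM0 hL hM

end Support

section MaurerCartan

variable {k V : Type*} [Field k] [Quiver V] [Fintype V] {I : TwoSidedIdeal (PathAlgebra k V)}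

/-! ### Vanishing of the higher brackets on cocycles -/

variable (hI : IsGentle I)

/-- The bilinear map sending a path `u α` and `y` to `u y`, and the other paths to zero. -/
def removeLast (α : Arrow V) : QuotAlg I →ₗ[k] QuotAlg I →ₗ[k] QuotAlg I :=
  hI.pathBasis.constr k fun p =>
    if ∃ u, arr p.1.2.2 = u ++ [α] then LinearMap.mul k _ (ev I (arr p.1.2.2).dropLast) else 0

variable (hcyc : NoOrientedCycles V) (hpar : NoParallelArrows V)

theorem removeLast_ev {z : List (Arrow V)} (hz : (hI.boundQuiver hcyc hpar).NZ z) (hz0 : z ≠ [])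
    (α : Arrow V) : removeLast hI α (ev I z) =
      if ∃ u, z = u ++ [α] then LinearMap.mul k _ (ev I z.dropLast) else 0 := by
  obtain ⟨p, rfl⟩ := exists_path_of_nz hI hcyc hpar hz hz0
  have hp := cls_ne_zero hI hcyc hpar hz
  have h := hI.pathBasis.constr_basis k (fun p =>
    if ∃ u, arr p.1.2.2 = u ++ [α] then LinearMap.mul k (QuotAlg I) (ev I (arr p.1.2.2).dropLast)
    else 0) ⟨p, hp⟩
  rwa [pathBasis_apply, cls_eq_ev hz0] at h

theorem removeLast_ev_concat {u : List (Arrow V)} {α : Arrow V}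
    (hz : (hI.boundQuiver hcyc hpar).NZ (u ++ [α])) (y : QuotAlg I) :
    removeLast hI α (ev I (u ++ [α])) y = ev I u * y := by
  rw [removeLast_ev hI hcyc hpar hz (by simp), if_pos ⟨u, rfl⟩, List.dropLast_concat]
  rfl

theorem removeLast_ev_of_ne {z : List (Arrow V)} {α : Arrow V}
    (hz : (hI.boundQuiver hcyc hpar).NZ z) (hz0 : z ≠ []) (h : ¬ ∃ u, z = u ++ [α])
    (y : QuotAlg I) : removeLast hI α (ev I z) y = 0 := by
  rw [removeLast_ev hI hcyc hpar hz hz0, if_neg h, LinearMap.zero_apply]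

theorem eq_of_span {T : Set (List (Arrow V))} {x : QuotAlg I} {F G : QuotAlg I →ₗ[k] QuotAlg I}
    (hx : x ∈ Submodule.span k (ev I '' T)) (h : ∀ w ∈ T, F (ev I w) = G (ev I w)) : F x = G x := by
  refine LinearMap.eqOn_span ?_ hx
  rintro _ ⟨w, hw, rfl⟩
  exact h w hw

variable {α₁ α₂ α₃ : Arrow V}

/-- Only the paths `u α₂` in `g(α₁, α₂)` contribute, as `α₂` is the only arrow forming a relation
with `α₃`; the result is `u f(α₂, α₃)`. -/
theorem GStar_GStar_left (hcyc : NoOrientedCycles V) (hpar : NoParallelArrows V)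
    {f g : BardzellOne I} (hg : IsTwoCocycle g)
    (h12 : IsRel I α₁ α₂) (h23 : IsRel I α₂ α₃) :
    GStar hI f (GStar hI g (ev I [α₁] ⊗ₜ[k] ev I [α₂]) ⊗ₜ[k] ev I [α₃]) =
      removeLast hI α₂ (g.1 ⟨(α₁, α₂), h12⟩) (f.1 ⟨(α₂, α₃), h23⟩) := by
  have h1 := GStar_ev hI hcyc hpar g (u := []) (β := α₁) (γ := α₂) (v := []) (by simp) (by simp)
  rw [List.nil_append, dif_pos h12, ev_nil, one_mul, mul_one] at h1
  rw [h1]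
  refine eq_of_span (F := GStar hI f ∘ₗ (TensorProduct.mk k _ _).flip (ev I [α₃]))
    (G := (removeLast hI α₂).flip _) (hg.mem_span hI hcyc hpar ⟨(α₁, α₂), h12⟩) ?_
  rintro z ⟨hz0, hz, hzw, -⟩
  rw [LinearMap.comp_apply, LinearMap.flip_apply, LinearMap.flip_apply, mk_apply]
  rcases List.eq_nil_or_concat z with rfl | ⟨u, c, rfl⟩
  · exact (hz0 rfl).elim
  rw [List.concat_eq_append] at *
  rw [GStar_ev hI hcyc hpar f hz (by simp)]
  by_cases hc : IsRel I c α₃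
  · obtain rfl := hI.rel_left _ _ _ hc h23
    rw [dif_pos hc, removeLast_ev_concat hI hcyc hpar hz, ev_nil, mul_one]
  · rw [dif_neg hc, removeLast_ev_of_ne hI hcyc hpar hz hz0]
    rintro ⟨u', hu⟩
    obtain rfl : c = α₂ := by simpa using (List.append_inj' hu rfl).2
    exact hc h23

/-- A path `α₂ v` in `g(α₂, α₃)` gives `f(α₁, α₂) v`, in which only the paths `u α₂` of `f(α₁, α₂)`
survive, since `α₂` is the only arrow preceding `v` without a relation. Paths of `g(α₂, α₃)` with
another first arrow contribute zero to both sides. -/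
theorem GStar_GStar_right (hcyc : NoOrientedCycles V) (hpar : NoParallelArrows V)
    {f g : BardzellOne I} (hf : IsTwoCocycle f) (hg : IsTwoCocycle g)
    (h12 : IsRel I α₁ α₂) (h23 : IsRel I α₂ α₃) :
    GStar hI f (ev I [α₁] ⊗ₜ[k] GStar hI g (ev I [α₂] ⊗ₜ[k] ev I [α₃])) =
      removeLast hI α₂ (f.1 ⟨(α₁, α₂), h12⟩) (g.1 ⟨(α₂, α₃), h23⟩) := by
  set B := hI.boundQuiver hcyc hpar
  have h1 := GStar_ev hI hcyc hpar g (u := []) (β := α₂) (γ := α₃) (v := []) (by simp) (by simp)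
  rw [List.nil_append, dif_pos h23, ev_nil, one_mul, mul_one] at h1
  rw [h1]
  refine eq_of_span (F := GStar hI f ∘ₗ TensorProduct.mk k _ _ (ev I [α₁]))
    (G := removeLast hI α₂ _) (hg.mem_span hI hcyc hpar ⟨(α₂, α₃), h23⟩) ?_
  rintro z ⟨hz0, hz, hzw, -⟩
  rw [LinearMap.comp_apply, mk_apply]
  rcases z with _ | ⟨c, v⟩
  · exact (hz0 rfl).elim
  have h2 := GStar_ev hI hcyc hpar f (u := []) (β := α₁) (γ := c) (v := v) (by simp) hz
  simp only [List.nil_append, ev_nil, one_mul] at h2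
  rw [h2]
  by_cases hc : IsRel I α₁ c
  · obtain rfl := hI.rel_right _ _ _ hc h12
    rw [dif_pos hc]
    have hv : ∃ d v', v = d :: v' := by
      rcases v with _ | ⟨d, v'⟩
      · have h3 : B.tgt c = B.tgt α₃ := hzw.2
        exact (BoundQuiver.src_ne_tgt (B := B) α₃ (by rw [← h3]; exact h23.1.symm)).elim
      · exact ⟨d, v', rfl⟩
    obtain ⟨d, v', rfl⟩ := hv
    refine eq_of_span (F := LinearMap.mulRight k (ev I (d :: v')))
      (G := (removeLast hI c).flip _) (hf.mem_span hI hcyc hpar ⟨(α₁, c), h12⟩) ?_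
    rintro y ⟨hy0, hy, hyw, -⟩
    rw [LinearMap.flip_apply, LinearMap.mulRight_apply]
    by_cases hyc : ∃ u, y = u ++ [c]
    · obtain ⟨u, rfl⟩ := hyc
      rw [removeLast_ev_concat hI hcyc hpar hy, ev_append, ev_cons c (d :: v'), ev_cons c, ev_nil,
        mul_one, mul_assoc]
    · rw [removeLast_ev_of_ne hI hcyc hpar hy hy0 hyc, ← ev_append]
      refine ev_eq_zero hI hcyc hpar fun h3 => hyc ?_
      rcases List.eq_nil_or_concat y with rfl | ⟨u, e, rfl⟩
      · exact (hy0 rfl).elim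
      · have h4 : B.NZ (u ++ e :: d :: v') := by simpa using h3
        have h5 := (BoundQuiver.nz_split.1 h4).2.1
        have h6 := (BoundQuiver.nz_cons_cons.1 hz).1
        obtain rfl := B.non_left h5 h6
        exact ⟨u, by simp⟩
  · rw [dif_neg hc]
    symm
    refine eq_of_span (F := (removeLast hI α₂).flip (ev I (c :: v))) (G := 0)
      (hf.mem_span hI hcyc hpar ⟨(α₁, α₂), h12⟩) ?_
    rintro y ⟨hy0, hy, hyw, -⟩
    rw [LinearMap.flip_apply, LinearMap.zero_apply]
    by_cases hyc : ∃ u, y = u ++ [α₂]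
    · obtain ⟨u, rfl⟩ := hyc
      rw [removeLast_ev_concat hI hcyc hpar hy, ← ev_append]
      refine ev_eq_zero hI hcyc hpar fun h3 => hc ?_
      rcases List.eq_nil_or_concat u with rfl | ⟨u, e, rfl⟩
      · have h4 : B.src α₂ = B.src α₁ := hyw.1
        refine (BoundQuiver.src_ne_tgt (B := B) α₁ ?_).elim
        rw [← h4]; exact h12.1.symm
      · have h4 : B.NZ (u ++ e :: α₂ :: []) := by simpa using hy
        have h5 : B.NZ (u ++ e :: c :: v) := by simpa using h3
        rw [BoundQuiver.nz_split] at h4 h5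
        obtain rfl := B.non_right h4.2.1 h5.2.1
        exact h12
    · exact removeLast_ev_of_ne hI hcyc hpar hy hy0 hyc _

/-- The left composition of `f` with `g` equals the right composition of `g` with `f`, so the signs
of the bracket cancel them. -/
theorem bracket_GStar (hcyc : NoOrientedCycles V) (hpar : NoParallelArrows V)
    {f g : BardzellOne I} (hf : IsTwoCocycle f) (hg : IsTwoCocycle g)
    (h12 : IsRel I α₁ α₂) (h23 : IsRel I α₂ α₃) :
    bracket (GStar hI f) (GStar hI g) (ev I [α₁] ⊗ₜ[k] (ev I [α₂] ⊗ₜ[k] ev I [α₃])) = 0 := by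
  rw [bracket, LinearMap.add_apply, circ_tmul, circ_tmul,
    GStar_GStar_left hI hcyc hpar hg h12 h23, GStar_GStar_left hI hcyc hpar hf h12 h23,
    GStar_GStar_right hI hcyc hpar hf hg h12 h23, GStar_GStar_right hI hcyc hpar hg hf h12 h23]
  abel

/-- The inner map meets a single relation, which forces `n = 1` and hence `m ≥ 2`; the two overlap
results then apply. -/
theorem Supported.circ_eq_zero {m n : ℕ} {φ ψ : HochTwo I} (hφ : Supported hI hcyc hpar m φ)
    (hψ : Supported hI hcyc hpar n ψ) (hn : n ≠ 0) (hmn : 3 ≤ m + n)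
    (h12 : IsRel I α₁ α₂) (h23 : IsRel I α₂ α₃) :
    circ φ ψ (ev I [α₁] ⊗ₜ[k] (ev I [α₂] ⊗ₜ[k] ev I [α₃])) = 0 := by
  have key : ∀ {L M : List (Arrow V)}, L ≠ [] → M ≠ [] → (hI.boundQuiver hcyc hpar).NZ L →
      (hI.boundQuiver hcyc hpar).NZ M →
      (∀ w, (hI.boundQuiver hcyc hpar).NZ w → ¬ (hI.boundQuiver hcyc hpar).Reach m (L ++ M) w) →
      φ (ev I L ⊗ₜ[k] ev I M) = 0 := by
    intro L M hL0 hM0 hL hM h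
    have h1 := hφ.mem L M hL0 hM0 hL hM
    have h2 : reachSpan hI hcyc hpar m (L ++ M) = ⊥ := by
      rw [reachSpan, Submodule.span_eq_bot]
      rintro _ ⟨w, ⟨-, hw, hr⟩, rfl⟩
      exact (h w hw hr).elim
    rwa [h2, Submodule.mem_bot] at h1
  rw [circ_tmul]
  have hl : φ (ψ (ev I [α₁] ⊗ₜ[k] ev I [α₂]) ⊗ₜ[k] ev I [α₃]) = 0 := by
    refine eq_of_span (F := φ ∘ₗ (TensorProduct.mk k _ _).flip (ev I [α₃])) (G := 0)
      (hψ.rel_mem hn h12) ?_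
    rintro z ⟨rfl, hz⟩
    refine key hz.1 (by simp) hz.2.1 (by simp) fun w hw hr => ?_
    exact BoundQuiver.left_not_reach (B := hI.boundQuiver hcyc hpar) h12 h23 hz (by omega) hr hw
  have hr : φ (ev I [α₁] ⊗ₜ[k] ψ (ev I [α₂] ⊗ₜ[k] ev I [α₃])) = 0 := by
    refine eq_of_span (F := φ ∘ₗ TensorProduct.mk k _ _ (ev I [α₁])) (G := 0)
      (hψ.rel_mem hn h23) ?_
    rintro z ⟨rfl, hz⟩
    refine key (by simp) hz.1 (by simp) hz.2.1 fun w hw hr => ?_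
    exact BoundQuiver.right_not_reach (B := hI.boundQuiver hcyc hpar) h12 h23 hz (by omega) hr hw
  rw [hl, hr, sub_zero]

/-- The brackets `lₙ` with `n ≥ 2` vanish on cocycles. -/
theorem lMap_eq_zero (hcyc : NoOrientedCycles V) (hpar : NoParallelArrows V)
    {n : ℕ} (hn : 2 ≤ n) (f : Fin n → BardzellOne I)
    (hf : ∀ i, IsTwoCocycle (f i)) (ω : AP3 I) : lMap hI n f ω = 0 := by
  obtain _ | _ | m := n
  · omega
  · omega
  obtain ⟨⟨α₁, α₂, α₃⟩, h12, h23⟩ := ω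
  rw [lMap]
  change hat I (vMap hI (m + 2) f) (F3 _) = 0
  rw [F3, hat_tmul, one_mul, mul_one]
  dsimp only at h12 h23 ⊢
  have h1 : ∀ α : Arrow V, cls I α.toQPath = ev I [α] := fun α => by simp
  rw [h1, h1, h1]
  suffices h : vMap hI (m + 2) f ∈ valueSubmodule (⊥ : Submodule k (QuotAlg I))
      (ev I [α₁] ⊗ₜ[k] (ev I [α₂] ⊗ₜ[k] ev I [α₃])) 1 by
    rwa [mem_valueSubmodule, Submodule.mem_bot, mul_one] at h
  refine vMap_mem hI fun t s a b ht hs hts ha hb => ?_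
  rw [mem_valueSubmodule, Submodule.mem_bot, mul_one]
  have ha' : ∀ i, IsTwoCocycle (a i) := fun i => by
    obtain ⟨j, hj⟩ := ha i
    rw [hj]; exact hf j
  have hb' : ∀ i, IsTwoCocycle (b i) := fun i => by
    obtain ⟨j, hj⟩ := hb i
    rw [hj]; exact hf j
  by_cases hts1 : t = 1 ∧ s = 1
  · obtain ⟨rfl, rfl⟩ := hts1
    rw [phiMap, phiMap]
    exact bracket_GStar hI hcyc hpar (ha' 0) (hb' 0) h12 h23
  · have h2 := supported_phiMap hI hcyc hpar t ht a ha'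
    have h3 := supported_phiMap hI hcyc hpar s hs b hb'
    rw [bracket, LinearMap.add_apply, h2.circ_eq_zero hI hcyc hpar h3 hs (by omega) h12 h23,
      h3.circ_eq_zero hI hcyc hpar h2 ht (by omega) h12 h23, add_zero]

-- The coefficients of the Maurer–Cartan equation and the induction.

theorem lCoeff_one (f : ℕ → BardzellOne I) {i : ℕ} (hi : 1 ≤ i) (ω : AP3 I) :
    lCoeff hI f 1 i ω = -delta2 (f i) ω := by
  rw [lCoeff, Finset.Nat.antidiagonalTuple_one, Finset.filter_singleton, if_pos fun a => by
    fin_cases a; exact hi, Finset.sum_singleton]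
  rfl

/-- With at least two positive parts summing to `i`, each part is smaller than `i`. -/
theorem lCoeff_eq_zero (hcyc : NoOrientedCycles V) (hpar : NoParallelArrows V)
    (f : ℕ → BardzellOne I) {n i : ℕ} (hn : 2 ≤ n)
    (hf : ∀ j, 1 ≤ j → j < i → IsTwoCocycle (f j)) (ω : AP3 I) : lCoeff hI f n i ω = 0 := by
  refine Finset.sum_eq_zero fun j hj => ?_
  rw [Finset.mem_filter, Finset.Nat.mem_antidiagonalTuple] at hj
  obtain ⟨hj, hj1⟩ := hj
  refine lMap_eq_zero hI hcyc hpar hn _ (fun a => hf _ (hj1 a) ?_) ω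
  obtain ⟨b, hb⟩ : ∃ b : Fin n, b ≠ a := by
    have : Nontrivial (Fin n) := Fin.nontrivial_iff_two_le.2 hn
    exact exists_ne a
  have h1 : j a + j b ≤ ∑ c, j c := by
    rw [← Finset.sum_pair hb.symm]
    exact Finset.sum_le_sum_of_subset (Finset.subset_univ _)
  have h2 := hj1 b
  omega

/-- The Maurer-Cartan equation is equivalent to the cocycle condition. Since the brackets only have to
vanish on cocycles, neither the absence of the subquivers `HasStar` nor the characteristic of `k`
plays a role. -/
theorem isMaurerCartan_iff (hcyc : NoOrientedCycles V) (hpar : NoParallelArrows V)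
    (f : ℕ → BardzellOne I) :
    IsMaurerCartan hI f ↔ ∀ i : ℕ, 1 ≤ i → IsTwoCocycle (f i) := by
  -- Only the cocycle condition below `i` is assumed, so the same identity serves the strong
  -- induction and the converse.
  have key : ∀ i, 1 ≤ i → (∀ j, 1 ≤ j → j < i → IsTwoCocycle (f j)) → ∀ ω : AP3 I,
      lCoeff hI f 1 i ω -
        ∑ n ∈ Finset.Icc 2 i,
          ((-1 : k) ^ ((n + 1) * n / 2) * (n.factorial : k)⁻¹) • lCoeff hI f n i ω =
        -delta2 (f i) ω := by
    intro i hi hf ω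
    rw [lCoeff_one hI f hi, Finset.sum_eq_zero, sub_zero]
    intro n hn
    rw [lCoeff_eq_zero hI hcyc hpar f (Finset.mem_Icc.1 hn).1 hf, smul_zero]
  constructor
  · intro h i
    induction i using Nat.strong_induction_on with
    | _ i ih =>
      intro hi ω
      have h1 := h i hi ω
      rw [key i hi (fun j hj hji => ih j hji hj) ω] at h1
      exact neg_eq_zero.1 h1
  · intro h i hi ω
    rw [key i hi (fun j hj _ => h j hj) ω, h i hi ω, neg_zero]

end MaurerCartan

end GentleMC

end

theorem mainTheorem3 {k V : Type*} [Field k] [CharZero k] [Quiver V] [Fintype V]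
    (I : TwoSidedIdeal (GentleMC.PathAlgebra k V)) (hI : GentleMC.IsGentle I)
    (hcyc : GentleMC.NoOrientedCycles V) (hpar : GentleMC.NoParallelArrows V)
    (hstar : ¬ GentleMC.HasStar I) (f : ℕ → GentleMC.BardzellOne I) :
    GentleMC.IsMaurerCartan hI f ↔ ∀ i : ℕ, 1 ≤ i → GentleMC.IsTwoCocycle (f i) := by
  exact GentleMC.isMaurerCartan_iff hI hcyc hpar f
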